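/- Let $\mathcal X,\mathcal Y,\mathcal Z$ be finite sets. A distribution $q$ on $\mathcal X\times\mathcal Y\times\mathcal Z$ is *conditionally independent* if, for $(X,Y,Z)\sim q$, $\Pr[X=i,Y=j\mid Z=z]=\Pr[X=i\mid Z=z]\cdot\Pr[Y=j\mid Z=z]$ for all $i\in\mathcal X$, $j\in\mathcal Y$ and all $z\in\mathcal Z$ with $\Pr[Z=z]>0$. For $\varepsilon>0$, a distribution $p$ on $\mathcal X\times\mathcal Y\times\mathcal Z$ is *$\varepsilon$-far from conditional independence* if $d_{\mathrm{TV}}(p,q)=\tfrac12\sum_\omega|p(\omega)-q(\omega)|>\varepsilon$ for every conditionally independent $q$. An *$s$-sample $\varepsilon$-tester for conditional independence* on $\mathcal X\times\mathcal Y\times\mathcal Z$ is a (possibly randomized) procedure that, given $s$ independent samples from an unknown distribution $p$ on $\mathcal X\times\mathcal Y\times\mathcal Z$, outputs "accept" or "reject" such that - if $p$ is conditionally independent, it accepts with probability at least $2/3$; - if $p$ is $\varepsilon$-far from conditional independence, it rejects with probability at least $2/3$. **Theorem.** Any tester for conditional independence with $|\mathcal X|=|\mathcal Y|=|\mathcal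 Z|=n$ and $\varepsilon=1/20$ requires $\Omega(n^{7/4})$ samples. That is, there are a constant $c>0$ and an $n_0\in\mathbb N$ such that, for every $n\ge n_0$, all sets $\mathcal X,\mathcal Y,\mathcal Z$ with $|\mathcal X|=|\mathcal Y|=|\mathcal Z|=n$ and every $s\in\mathbb N$: if there is an $s$-sample $\tfrac1{20}$-tester for conditional independence on $\mathcal X\times\mathcal Y\times\mathcal Z$, then $s\ge c\,n^{7/4}$. -/

import Mathlib

namespace CondIndepTesting

/-- A probability distribution over a finite domain `Ω` is an element `p` of `stdSimplex ℝ Ω`: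
a nonnegative function `p : Ω → ℝ` of total mass one. For `p` on `X × Y × Z`, this is the
probability that `Z = z`. -/
def probZ {X Y Z : Type*} [Fintype X] [Fintype Y] (p : X × Y × Z → ℝ) (z : Z) : ℝ :=
  ∑ i : X, ∑ j : Y, p (i, j, z)

/-- The conditional probability that `X = i` and `Y = j` given `Z = z`. -/
noncomputable def condXY {X Y Z : Type*} [Fintype X] [Fintype Y] (p : X × Y × Z → ℝ)
    (z : Z) (i : X) (j : Y) : ℝ :=
  p (i, j, z) / probZ p z

/-- The conditional probability that `X = i` given `Z = z`. -/
noncomputable def condX {X Y Z : Type*} [Fintype X] [Fintype Y] (p : X × Y × Z → ℝ)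
    (z : Z) (i : X) : ℝ :=
  (∑ j : Y, p (i, j, z)) / probZ p z

/-- The conditional probability that `Y = j` given `Z = z`. -/
noncomputable def condY {X Y Z : Type*} [Fintype X] [Fintype Y] (p : X × Y × Z → ℝ)
    (z : Z) (j : Y) : ℝ :=
  (∑ i : X, p (i, j, z)) / probZ p z

/-- The property of conditional independence of `X` and `Y` given `Z`. When `Z = z` has
probability zero, all three quotients are `0 / 0 = 0` in Lean and the equation holds, so that
such a `z` imposes no condition, as usual. -/
def condIndep (X Y Z : Type*) [Fintype X] [Fintype Y] [Fintype Z] : Set (X × Y × Z → ℝ) :=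
  {p | p ∈ stdSimplex ℝ (X × Y × Z) ∧
    ∀ (i : X) (j : Y) (z : Z), condXY p z i j = condX p z i * condY p z j}

/-- Total variation distance of two distributions over a finite domain. -/
noncomputable def tvDist {Ω : Type*} [Fintype Ω] (p q : Ω → ℝ) : ℝ :=
  (1 / 2) * ∑ ω : Ω, |p ω - q ω|

/-- `p` is `ε`-far from the property `P`. -/
def IsFar {Ω : Type*} [Fintype Ω] (ε : ℝ) (p : Ω → ℝ) (P : Set (Ω → ℝ)) : Prop :=
  ∀ q ∈ P, ε < tvDist p q

/-- A randomized decision rule on `s` samples from `Ω`: on the sample sequence `x` it outputs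
`accept` with probability `accept x`, and `reject` with probability `1 - accept x`. Arbitrary
computation and internal randomness are allowed. -/
structure DecisionRule (s : ℕ) (Ω : Type*) where
  accept : (Fin s → Ω) → ℝ
  accept_nonneg : ∀ x, 0 ≤ accept x
  accept_le_one : ∀ x, accept x ≤ 1

/-- The probability that `A` accepts, when it is given `s` independent samples from `p`. -/
def DecisionRule.acceptProb {s : ℕ} {Ω : Type*} [Fintype Ω] (A : DecisionRule s Ω)
    (p : Ω → ℝ) : ℝ :=
  ∑ x : Fin s → Ω, (∏ i : Fin s, p (x i)) * A.accept x

/-- The probability that `A` rejects, when it is given `s` independent samples from `p`. -/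
def DecisionRule.rejectProb {s : ℕ} {Ω : Type*} [Fintype Ω] (A : DecisionRule s Ω)
    (p : Ω → ℝ) : ℝ :=
  ∑ x : Fin s → Ω, (∏ i : Fin s, p (x i)) * (1 - A.accept x)

/-- `A` is a tester for conditional independence over `X × Y × Z` with distance parameter `ε`:
it accepts conditionally independent distributions, and rejects distributions that are `ε`-far
from conditional independence, with probability at least `2/3` each. A tester that has to reject
also at distance exactly `ε` is in particular a tester in this sense. -/
def IsTester {s : ℕ} {X Y Z : Type*} [Fintype X] [Fintype Y] [Fintype Z]
    (A : DecisionRule s (X × Y × Z)) (ε : ℝ) : Prop :=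
  (∀ p ∈ condIndep X Y Z, 2 / 3 ≤ A.acceptProb p) ∧
  (∀ p ∈ stdSimplex ℝ (X × Y × Z), IsFar ε p (condIndep X Y Z) → 2 / 3 ≤ A.rejectProb p)

end CondIndepTesting

set_option linter.unusedSectionVars false

namespace CondIndepTesting

open Finset

/-! Hard instances: `Z` is uniform and each of its values (a bin) has an independent hidden state.
`X` carries a row and a bit, `Y` a column and a bit; rows and columns range over a set of about n/2
elements. In each bin about n^(3/4) secret rows, and as many secret columns, are heavy and share
half of the mass. In the null case row, column and bits are independent. In the alternative the
parity of the two bits is fixed by a random sign in every cell with light row and light column. Such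
cells have total mass 1/4, and a perfectly correlated 2 × 2 block is far from rank one, so the
alternative has distance at least 1/16 > 1/20 (`one_eighth_le_sum_abs_altLaw_sub`).

Why few samples do not help: let a bin hold at most K samples, K of order n^(3/4). A lone parity is
averaged out by the random sign, so only collisions in light cells carry information. A light cell
has mass O(n⁻²), hence two light collisions in a bin have probability O(K⁴/n⁴) = O(1/n); these are
removed by truncation at a small total cost (`sum_abs_binLaw_sub_le`). A single light collision is
masked by heavy ones: given that two samples share a cell, that cell is light with posterior
probability O((h/n)²) for h heavy rows and columns, provided K ≤ h/2
(`sum_prod_rowWeight_light_le`). By Parseval the χ² divergence of a truncated bin is therefore O(K²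
· (h/n)² · n⁻²) = O(1/n) (`sum_sq_binLaw_div_le`). Since χ² tensorizes, all n bins together give a
small constant.

If s is below a small multiple of n^(7/4), the average occupancy is at most K/4 and an overfull bin
is very unlikely (`card_large_fiber_le`). The two mixtures are then closer than any tester permits
(`one_third_le_sum_abs_mixture_sub`). -/

/-! ### Independence across bins and distances of product laws -/

theorem sum_fiber {T Z D : Type*} [Fintype T] [DecidableEq T] [Fintype Z] [DecidableEq Z]
    [Fintype D] (ζ : T → Z) (G : (∀ z, {t // ζ t = z} → D) → ℝ) :
    ∑ d : T → D, G (fun _ t => d t) = ∑ e, G e := by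
  let φ : (T → D) ≃ (∀ z, {t // ζ t = z} → D) :=
    { toFun := fun d z t => d t
      invFun := fun e t => e (ζ t) ⟨t, rfl⟩
      left_inv := fun d => rfl
      right_inv := by
        intro e
        funext z ⟨t, ht⟩
        subst ht
        rfl }
  exact Fintype.sum_equiv φ _ _ fun d => rfl

/-- Expanding a product of sums chooses one state per label. Hence, once the labels are fixed, the
bins are independent. -/
theorem sum_mixture_eq_prod {T Z D Ψ : Type*} [Fintype T] [Fintype Z] [DecidableEq Z]
    [Fintype Ψ] (ζ : T → Z) (w : Ψ → ℝ) (μ : Ψ → D → ℝ) (d : T → D) :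
    ∑ θ : Z → Ψ, (∏ z, w (θ z)) * ∏ t, μ (θ (ζ t)) (d t) =
      ∏ z, ∑ ψ, w ψ * ∏ t : {t // ζ t = z}, μ ψ (d t) := by
  rw [Finset.prod_univ_sum, Fintype.piFinset_univ]
  refine Finset.sum_congr rfl fun θ _ => ?_
  rw [Finset.prod_mul_distrib, ← Fintype.prod_fiberwise ζ (fun t => μ (θ (ζ t)) (d t))]
  congr 1
  refine Finset.prod_congr rfl fun z _ => Finset.prod_congr rfl fun t _ => ?_
  rw [t.2]

/-- Hybrid argument: exchange the factors one at a time; in each step the unchanged factors sum to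
one. -/
theorem sum_abs_prod_sub_prod_le {n : ℕ} {E : Fin n → Type*} [∀ z, Fintype (E z)]
    (P Q : ∀ z, E z → ℝ) (hP : ∀ z e, 0 ≤ P z e) (hQ : ∀ z e, 0 ≤ Q z e)
    (sP : ∀ z, ∑ e, P z e = 1) (sQ : ∀ z, ∑ e, Q z e = 1) :
    ∑ e : ∀ z, E z, |∏ z, P z (e z) - ∏ z, Q z (e z)| ≤ ∑ z, ∑ e, |P z e - Q z e| := by
  have key : ∀ z : Fin n, ∑ e : ∀ z, E z, |P z (e z) - Q z (e z)| *
      (∏ y ∈ univ.filter (· < z), P y (e y)) * (∏ y ∈ univ.filter (z < ·), Q y (e y)) =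
      ∑ e, |P z e - Q z e| := by
    intro z
    let F : ∀ y, E y → ℝ := fun y e => (if y = z then |P y e - Q y e| else 1) *
      (if y < z then P y e else 1) * (if z < y then Q y e else 1)
    have h1 : ∀ e : ∀ z, E z, |P z (e z) - Q z (e z)| *
      (∏ y ∈ univ.filter (· < z), P y (e y)) * (∏ y ∈ univ.filter (z < ·), Q y (e y)) =
        ∏ y, F y (e y) := by
      intro e
      simp only [F, Finset.prod_mul_distrib]
      rw [Finset.prod_filter, Finset.prod_filter]
      congr 2
      rw [Finset.prod_ite_eq' univ z (fun y => |P y (e y) - Q y (e y)|)]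
      simp
    simp only [h1]
    rw [← Fintype.piFinset_univ, ← Finset.prod_univ_sum]
    rw [Fintype.prod_eq_single z]
    · simp [F]
    · intro y hy
      rcases lt_or_gt_of_ne hy with h | h
      · simp [F, hy, h, h.not_gt, sP]
      · simp [F, hy, h, h.not_gt, sQ]
  rw [← Finset.sum_congr rfl fun z _ => key z, Finset.sum_comm]
  refine Finset.sum_le_sum fun e _ => ?_
  -- Writing P = Q + (P − Q), the ordered expansion is the telescoping sum of hybrids: P before `z`,
  -- the difference at `z`, Q after it.
  have := Finset.prod_add_ordered univ (fun z => Q z (e z)) (fun z => P z (e z) - Q z (e z))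
  simp only [add_sub_cancel] at this
  rw [this, add_sub_cancel_left]
  refine (Finset.abs_sum_le_sum_abs _ _).trans (Finset.sum_le_sum fun z _ => ?_)
  rw [abs_mul, abs_mul, Finset.abs_prod, Finset.abs_prod]
  simp only [abs_of_nonneg (hP _ _), abs_of_nonneg (hQ _ _), le_refl]

/-- Cauchy–Schwarz with weight `Q`; the right side is the χ² divergence. -/
theorem sq_sum_abs_sub_le {E : Type*} [Fintype E] (P Q : E → ℝ) (hQ : ∀ e, 0 < Q e)
    (sP : ∑ e, P e = 1) (sQ : ∑ e, Q e = 1) :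
    (∑ e, |P e - Q e|) ^ 2 ≤ ∑ e, P e ^ 2 / Q e - 1 := by
  have h := Finset.sum_sq_le_sum_mul_sum_of_sq_le_mul univ (r := fun e => |P e - Q e|)
    (f := fun e => (P e - Q e) ^ 2 / Q e) (g := Q)
    (fun e _ => div_nonneg (sq_nonneg _) (hQ e).le) (fun e _ => (hQ e).le)
    (fun e _ => by rw [sq_abs, div_mul_cancel₀ _ (hQ e).ne'])
  rw [sQ, mul_one] at h
  refine h.trans (le_of_eq ?_)
  have : ∀ e, (P e - Q e) ^ 2 / Q e = P e ^ 2 / Q e - 2 * P e + Q e := by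
    intro e
    have := (hQ e).ne'
    field_simp
    ring
  simp only [this, Finset.sum_add_distrib, Finset.sum_sub_distrib, ← Finset.mul_sum, sP, sQ]
  ring

/-- One plus the χ² divergence is multiplicative. This replaces n times the ℓ¹ distance of a factor
by roughly √n times its χ² root, which the sharp exponent needs. -/
theorem sum_abs_prod_sub_prod_le_sqrt {n : ℕ} {E : Fin n → Type*} [∀ z, Fintype (E z)]
    (P Q : ∀ z, E z → ℝ) (hQ : ∀ z e, 0 < Q z e)
    (sP : ∀ z, ∑ e, P z e = 1) (sQ : ∀ z, ∑ e, Q z e = 1) {χ : ℝ}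
    (hχ : ∀ z, ∑ e, P z e ^ 2 / Q z e ≤ 1 + χ) :
    ∑ e : ∀ z, E z, |∏ z, P z (e z) - ∏ z, Q z (e z)| ≤ √((1 + χ) ^ n - 1) := by
  refine Real.le_sqrt_of_sq_le ?_
  refine (sq_sum_abs_sub_le (fun e : ∀ z, E z => ∏ z, P z (e z)) (fun e => ∏ z, Q z (e z))
    (fun e => Finset.prod_pos fun z _ => hQ z _) ?_ ?_).trans ?_
  · rw [← Fintype.piFinset_univ, ← Finset.prod_univ_sum]; simp [sP]
  · rw [← Fintype.piFinset_univ, ← Finset.prod_univ_sum]; simp [sQ]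
  · simp only [← Finset.prod_pow, ← Finset.prod_div_distrib]
    rw [← Fintype.piFinset_univ, ← Finset.prod_univ_sum (fun _ => univ) (fun z e => P z e ^ 2 / Q z e)]
    refine sub_le_sub_right ((Finset.prod_le_prod (fun z _ => Finset.sum_nonneg fun e _ =>
      div_nonneg (sq_nonneg _) (hQ z e).le) (fun z _ => hχ z)).trans (by simp)) _

/-- Tensorization: each factor `P z` is compared with `Q z` through an intermediate `P' z`, which
is close to `P z` in `ℓ¹` and to `Q z` in `χ²`. -/
theorem sum_abs_prod_sub_prod_le_add_sqrt {n : ℕ} {E : Fin n → Type*} [∀ z, Fintype (E z)]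
    (P P' Q : ∀ z, E z → ℝ) (hP : ∀ z e, 0 ≤ P z e) (hP' : ∀ z e, 0 ≤ P' z e)
    (hQ : ∀ z e, 0 < Q z e)
    (sP : ∀ z, ∑ e, P z e = 1) (sP' : ∀ z, ∑ e, P' z e = 1) (sQ : ∀ z, ∑ e, Q z e = 1)
    {χ b : ℝ} (hb : ∀ z, ∑ e, |P z e - P' z e| ≤ b)
    (hχ : ∀ z, ∑ e, P' z e ^ 2 / Q z e ≤ 1 + χ) :
    ∑ e : ∀ z, E z, |∏ z, P z (e z) - ∏ z, Q z (e z)| ≤ n * b + √((1 + χ) ^ n - 1) := by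
  have h1 := (sum_abs_prod_sub_prod_le P P' hP hP' sP sP').trans
    (Finset.sum_le_sum fun z _ => hb z)
  have h2 := sum_abs_prod_sub_prod_le_sqrt P' Q hQ sP' sQ hχ
  simp only [Finset.sum_const, Finset.card_univ, Fintype.card_fin, nsmul_eq_mul] at h1
  refine le_trans ?_ (add_le_add h1 h2)
  rw [← Finset.sum_add_distrib]
  exact Finset.sum_le_sum fun e _ => abs_sub_le _ _ _

/-- The number of labelings with more than `K` labels equal to some `z` is exponentially small. -/
theorem card_large_fiber_le {n s K : ℕ} :
    ((univ.filter fun ζ : Fin s → Fin n => ∃ z, K < Fintype.card {t // ζ t = z}).card : ℝ) * 2 ^ K ≤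
      n * (n + 1) ^ s := by
  classical
  -- The exponential moment of the occupancy of `z` factors over samples; Markov's inequality and a
  -- union bound over `z` follow.
  have h1 : ∀ z : Fin n, ∑ ζ : Fin s → Fin n, (2 : ℝ) ^ Fintype.card {t // ζ t = z} =
      (n + 1) ^ s := by
    intro z
    have : ∀ ζ : Fin s → Fin n, (2 : ℝ) ^ Fintype.card {t // ζ t = z} =
        ∏ t, if ζ t = z then 2 else 1 := by
      intro ζ
      rw [Finset.prod_ite, Fintype.card_subtype]
      simp
    simp only [this]
    rw [← Fintype.piFinset_univ, Finset.sum_prod_piFinset univ (fun _ y => if y = z then (2 : ℝ) else 1)]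
    have h2 : ∀ y : Fin n, (if y = z then (2 : ℝ) else 1) = 1 + if y = z then 1 else 0 := by
      intro y; split_ifs <;> norm_num
    simp only [h2, Finset.sum_add_distrib]
    simp
  calc _ = ∑ ζ : Fin s → Fin n, if ∃ z, K < Fintype.card {t // ζ t = z} then (2 : ℝ) ^ K else 0 := by
        rw [← Finset.sum_filter]; simp
    _ ≤ ∑ ζ : Fin s → Fin n, ∑ z, (2 : ℝ) ^ Fintype.card {t // ζ t = z} := by
        refine Finset.sum_le_sum fun ζ _ => ?_
        split_ifs with h
        · obtain ⟨z, hz⟩ := h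
          exact (pow_le_pow_right₀ one_le_two hz.le).trans
            (Finset.single_le_sum (f := fun z => (2 : ℝ) ^ Fintype.card {t // ζ t = z})
              (fun _ _ => by positivity) (mem_univ z))
        · positivity
    _ = _ := by rw [Finset.sum_comm]; simp [h1]

/-- The sign `±1` of a bit. -/
def bitSign (a : Bool) : ℝ := if a then 1 else -1

/-- The product of the signs of two bits. -/
def parity (β : Bool × Bool) : ℝ := bitSign β.1 * bitSign β.2

theorem bitSign_sq (a : Bool) : bitSign a * bitSign a = 1 := by cases a <;> simp [bitSign]

theorem parity_sq (β : Bool × Bool) : parity β * parity β = 1 := by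
  rw [parity, mul_mul_mul_comm, bitSign_sq, bitSign_sq, one_mul]

theorem parity_cases (β : Bool × Bool) : parity β = 1 ∨ parity β = -1 :=
  mul_self_eq_one_iff.mp (parity_sq β)

theorem sum_parity : ∑ β, parity β = 0 := by
  simp [Fintype.sum_prod_type, parity, bitSign]

/-! ### Characters of the sample bits -/

section Character

variable {T : Type*} [Fintype T] [DecidableEq T]

/-- The character of the bits indexed by `S`. -/
def character (S : Finset T) (β : T → Bool × Bool) : ℝ := ∏ t ∈ S, parity (β t)

/-- Orthogonality: the sum factors over samples, and a parity has mean zero and square one. -/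
theorem sum_character_mul (S S' : Finset T) :
    ∑ β, character S β * character S' β = if S = S' then (4 : ℝ) ^ Fintype.card T else 0 := by
  have h : ∀ β : T → Bool × Bool, character S β * character S' β =
      ∏ t, (if t ∈ S then parity (β t) else 1) * (if t ∈ S' then parity (β t) else 1) := by
    intro β
    rw [Finset.prod_mul_distrib]
    simp [character, Finset.prod_ite_mem]
  simp only [h]
  rw [← Fintype.piFinset_univ, ← Finset.prod_univ_sum (fun _ => univ)
    (fun t b => (if t ∈ S then parity b else 1) * (if t ∈ S' then parity b else 1))]
  split_ifs with hS
  · subst hS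
    have : ∀ t, ∑ b, (if t ∈ S then parity b else 1) * (if t ∈ S then parity b else 1) = 4 := by
      intro t
      by_cases ht : t ∈ S <;> simp [ht, parity_sq]
    rw [Finset.prod_congr rfl fun t _ => this t]
    simp
  · obtain ⟨t, ht⟩ : ∃ t, ¬(t ∈ S ↔ t ∈ S') := by
      by_contra! h
      exact hS (Finset.ext h)
    refine Finset.prod_eq_zero (mem_univ t) ?_
    by_cases h1 : t ∈ S <;> by_cases h2 : t ∈ S' <;> simp_all [sum_parity]

theorem sum_character {S : Finset T} (hS : S.Nonempty) : ∑ β, character S β = 0 := by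
  have := sum_character_mul S ∅
  rw [if_neg hS.ne_empty] at this
  simpa [character] using this

/-- Parseval; nonemptiness makes the characters orthogonal to the constant term. -/
theorem sum_sq_add_sum_character (𝓕 : Finset (Finset T)) (h𝓕 : ∀ S ∈ 𝓕, S.Nonempty) (a : ℝ)
    (p : Finset T → ℝ) :
    ∑ β, (a + ∑ S ∈ 𝓕, p S * character S β) ^ 2 =
      4 ^ Fintype.card T * (a ^ 2 + ∑ S ∈ 𝓕, p S ^ 2) := by
  have h : ∀ β : T → Bool × Bool, (a + ∑ S ∈ 𝓕, p S * character S β) ^ 2 = a ^ 2 +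
      (∑ S ∈ 𝓕, 2 * a * p S * character S β +
        ∑ S ∈ 𝓕, ∑ S' ∈ 𝓕, p S * p S' * (character S β * character S' β)) := by
    intro β
    rw [add_sq, add_assoc, sq (∑ S ∈ 𝓕, p S * character S β), Finset.sum_mul_sum, Finset.mul_sum]
    congr 2
    · exact Finset.sum_congr rfl fun S _ => by ring
    · exact Finset.sum_congr rfl fun S _ => Finset.sum_congr rfl fun S' _ => by ring
  simp only [h, Finset.sum_add_distrib]
  rw [Finset.sum_comm, Finset.sum_comm (t := 𝓕)]
  have h1 : ∀ S ∈ 𝓕, ∑ β, 2 * a * p S * character S β = 0 := fun S hS => by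
    rw [← Finset.mul_sum, sum_character (h𝓕 S hS), mul_zero]
  have h2 : ∀ S ∈ 𝓕, ∑ β, ∑ S' ∈ 𝓕, p S * p S' * (character S β * character S' β) =
      4 ^ Fintype.card T * p S ^ 2 := by
    intro S hS
    rw [Finset.sum_comm]
    simp only [← Finset.mul_sum, sum_character_mul]
    simp only [mul_ite, mul_zero, Finset.sum_ite_eq, if_pos hS]
    ring
  rw [Finset.sum_congr rfl h1, Finset.sum_congr rfl h2]
  simp [Finset.mul_sum, mul_add]

end Character

/-! ### Probabilities of collisions -/

section Collision

variable {T C : Type*} [Fintype T] [DecidableEq T] [Fintype C] [DecidableEq C]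

open scoped Classical in
/-- The pairs of samples that fall into the same cell of `L`. -/
noncomputable def collisions (L : C → Prop) (x : T → C) : Finset (Finset T) :=
  (powersetCard 2 univ).filter fun S => ∃ c, L c ∧ ∀ t ∈ S, x t = c

theorem mem_collisions {L : C → Prop} {x : T → C} {S : Finset T} :
    S ∈ collisions L x ↔ S.card = 2 ∧ ∃ c, L c ∧ ∀ t ∈ S, x t = c := by
  simp [collisions]

open scoped Classical in
-- Condition on all samples but `u`. The event forces sample `u` into the cell of `u'`, which costs
-- at most `l`, and `F` does not depend on `u`.
theorem sum_collision_le {b : C → ℝ} (hb : ∀ c, 0 ≤ b c) (sb : ∑ c, b c = 1) {L : C → Prop} {l : ℝ}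
    (hl : ∀ c, L c → b c ≤ l) (hl0 : 0 ≤ l) {u u' : T} (hu : u' ≠ u) {F : (T → C) → ℝ}
    (hF : ∀ x, 0 ≤ F x) (hFu : ∀ x c, F (Function.update x u c) = F x) :
    ∑ x : T → C, (∏ t, b (x t)) * (if L (x u) ∧ x u' = x u then F x else 0) ≤
      l * ∑ x : T → C, (∏ t, b (x t)) * F x := by
  let e := (Equiv.funSplitAt u C).symm
  have he : ∀ p, e p u = p.1 := fun p => by simp [e, Equiv.funSplitAt, Equiv.piSplitAt]
  have he' : ∀ p (t : {t // t ≠ u}), e p t = p.2 t := fun p t => by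
    simp [e, Equiv.funSplitAt, Equiv.piSplitAt, t.2]
  have hprod : ∀ p, ∏ t, b (e p t) = b p.1 * ∏ t : {t // t ≠ u}, b (p.2 t) := by
    intro p
    rw [Fintype.prod_eq_mul_prod_subtype_ne _ u, he]
    simp only [he']
  obtain h | ⟨⟨c₀⟩⟩ := isEmpty_or_nonempty C
  · have : IsEmpty (T → C) := ⟨fun f => h.elim (f u)⟩
    simp
  have hFe : ∀ p, F (e p) = F (e (c₀, p.2)) := by
    intro p
    rw [← hFu (e p) c₀]
    congr 1
    funext t
    by_cases ht : t = u
    · subst ht; simp [he]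
    · rw [Function.update_of_ne ht]
      exact (he' p ⟨t, ht⟩).trans (he' (c₀, p.2) ⟨t, ht⟩).symm
  rw [← e.sum_comp, ← e.sum_comp, Fintype.sum_prod_type_right, Fintype.sum_prod_type_right,
    Finset.mul_sum]
  refine Finset.sum_le_sum fun y _ => ?_
  have hR : ∑ c, (∏ t, b (e (c, y) t)) * F (e (c, y)) =
      (∏ t, b (y t)) * F (e (c₀, y)) := by
    simp only [hprod, hFe (_, y)]
    rw [← Finset.sum_mul, ← Finset.sum_mul, sb, one_mul]
  rw [hR]
  have hu' : ∀ c, e (c, y) u' = y ⟨u', hu⟩ := fun c => he' (c, y) ⟨u', hu⟩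
  simp only [hprod, hFe (_, y), he, hu']
  rw [Fintype.sum_eq_single (y ⟨u', hu⟩) (fun c hc => by simp [hc.symm])]
  have h0 : 0 ≤ (∏ t, b (y t)) * F (e (c₀, y)) :=
    mul_nonneg (Finset.prod_nonneg fun t _ => hb _) (hF _)
  split_ifs with h
  · rw [mul_assoc]
    exact mul_le_mul_of_nonneg_right (hl _ h.1) h0
  · rw [mul_zero]; exact mul_nonneg hl0 h0

theorem sum_pi_prod_eq_one {b : C → ℝ} (sb : ∑ c, b c = 1) : ∑ x : T → C, ∏ t, b (x t) = 1 := by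
  rw [← Fintype.piFinset_univ, Finset.sum_prod_piFinset univ (fun _ => b)]
  simp [sb]

open scoped Classical in
theorem sum_mem_collisions_le {b : C → ℝ} (hb : ∀ c, 0 ≤ b c) (sb : ∑ c, b c = 1) {L : C → Prop}
    {l : ℝ} (hl : ∀ c, L c → b c ≤ l) (hl0 : 0 ≤ l) (S : Finset T) :
    ∑ x : T → C, (∏ t, b (x t)) * (if S ∈ collisions L x then 1 else 0) ≤ l := by
  by_cases hS : S.card = 2
  · obtain ⟨u, u', huu, rfl⟩ := Finset.card_eq_two.mp hS
    have := sum_collision_le hb sb hl hl0 huu.symm (F := fun _ => 1) (T := T) (by simp) (by simp)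
    simp only [mul_one, sum_pi_prod_eq_one sb] at this
    refine (Finset.sum_le_sum fun x _ => ?_).trans this
    refine mul_le_mul_of_nonneg_left ?_ (Finset.prod_nonneg fun t _ => hb _)
    by_cases h : {u, u'} ∈ collisions L x
    · obtain ⟨-, c, hc, hx⟩ := mem_collisions.mp h
      have h1 := hx u (by simp)
      have h2 := hx u' (by simp)
      simp [h, h1, h2, hc]
    · rw [if_neg h]; split_ifs <;> norm_num
  · simp [mem_collisions, hS, hl0]

open scoped Classical in
-- Distinct pairs may overlap, but some `u` in `S'` lies outside `S`. The collision of `S` does not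
-- involve `u`, so each collision costs its own factor `l`.
theorem sum_mem_mem_collisions_le {b : C → ℝ} (hb : ∀ c, 0 ≤ b c) (sb : ∑ c, b c = 1)
    {L : C → Prop} {l : ℝ} (hl : ∀ c, L c → b c ≤ l) (hl0 : 0 ≤ l) {S S' : Finset T}
    (hSS : S ≠ S') :
    ∑ x : T → C, (∏ t, b (x t)) * (if S ∈ collisions L x ∧ S' ∈ collisions L x then 1 else 0) ≤
      l ^ 2 := by
  by_cases hS : S.card = 2 ∧ S'.card = 2
  · obtain ⟨u, hu', hu⟩ : ∃ u ∈ S', u ∉ S := by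
      by_contra! h
      exact hSS (Finset.eq_of_subset_of_card_le h (by rw [hS.1, hS.2])).symm
    obtain ⟨u', hu'', huu⟩ := Finset.exists_mem_ne (by omega : 1 < S'.card) u
    have hinv : ∀ x c, (if S ∈ collisions L (Function.update x u c) then (1 : ℝ) else 0) =
        if S ∈ collisions L x then 1 else 0 := by
      intro x c
      have : S ∈ collisions L (Function.update x u c) ↔ S ∈ collisions L x := by
        rw [mem_collisions, mem_collisions]
        refine and_congr_right fun _ => exists_congr fun c' => and_congr_right fun _ =>
          forall₂_congr fun t ht => ?_
        rw [Function.update_of_ne (by rintro rfl; exact hu ht)]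
      simp [this]
    have h1 := sum_collision_le hb sb hl hl0 huu
      (F := fun x => if S ∈ collisions L x then 1 else 0) (by intro x; positivity) hinv
    have h2 := mul_le_mul_of_nonneg_left (sum_mem_collisions_le (T := T) hb sb hl hl0 S) hl0
    rw [sq]
    refine (Finset.sum_le_sum fun x _ => ?_).trans (h1.trans h2)
    refine mul_le_mul_of_nonneg_left ?_ (Finset.prod_nonneg fun t _ => hb _)
    by_cases h : S ∈ collisions L x ∧ S' ∈ collisions L x
    · obtain ⟨-, c, hc, hx⟩ := mem_collisions.mp h.2
      have h1 := hx u hu'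
      have h2 := hx u' hu''
      simp [h, h1, h2, hc]
    · rw [if_neg h]; split_ifs <;> norm_num
  · have : ∀ x : T → C, ¬(S ∈ collisions L x ∧ S' ∈ collisions L x) := by
      intro x h
      rw [mem_collisions, mem_collisions] at h
      exact hS ⟨h.1.1, h.2.1⟩
    simp [this, sq_nonneg]

open scoped Classical in
theorem sum_two_le_card_collisions_le {b : C → ℝ} (hb : ∀ c, 0 ≤ b c) (sb : ∑ c, b c = 1)
    {L : C → Prop} {l : ℝ} (hl : ∀ c, L c → b c ≤ l) (hl0 : 0 ≤ l) :
    ∑ x : T → C, (∏ t, b (x t)) * (if 2 ≤ (collisions L x).card then 1 else 0) ≤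
      ((Fintype.card T).choose 2 : ℝ) ^ 2 * l ^ 2 := by
  let 𝓟 : Finset (Finset T) := powersetCard 2 univ
  have h1 : ∀ x : T → C, (if 2 ≤ (collisions L x).card then (1 : ℝ) else 0) ≤
      ∑ S ∈ 𝓟, ∑ S' ∈ 𝓟, if S ≠ S' then
        (if S ∈ collisions L x ∧ S' ∈ collisions L x then 1 else 0) else 0 := by
    intro x
    split_ifs with h
    · obtain ⟨S, hS, S', hS', hne⟩ := Finset.one_lt_card.mp h
      have hm : ∀ {S}, S ∈ collisions L x → S ∈ 𝓟 := fun h => (mem_filter.mp h).1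
      refine le_trans ?_ (Finset.single_le_sum (fun _ _ => Finset.sum_nonneg fun _ _ => by positivity)
        (hm hS))
      refine le_trans ?_ (Finset.single_le_sum (fun _ _ => by positivity) (hm hS'))
      simp [hne, hS, hS']
    · exact Finset.sum_nonneg fun _ _ => Finset.sum_nonneg fun _ _ => by positivity
  calc _ ≤ ∑ x : T → C, (∏ t, b (x t)) * ∑ S ∈ 𝓟, ∑ S' ∈ 𝓟, (if S ≠ S' then
        (if S ∈ collisions L x ∧ S' ∈ collisions L x then 1 else 0) else 0) :=
        Finset.sum_le_sum fun x _ => mul_le_mul_of_nonneg_left (h1 x)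
          (Finset.prod_nonneg fun t _ => hb _)
    _ = ∑ S ∈ 𝓟, ∑ S' ∈ 𝓟, ∑ x : T → C, (∏ t, b (x t)) * (if S ≠ S' then
        (if S ∈ collisions L x ∧ S' ∈ collisions L x then 1 else 0) else 0) := by
        simp only [Finset.mul_sum]
        rw [Finset.sum_comm]
        exact Finset.sum_congr rfl fun S _ => Finset.sum_comm
    _ ≤ ∑ S ∈ 𝓟, ∑ S' ∈ 𝓟, l ^ 2 := by
        refine Finset.sum_le_sum fun S _ => Finset.sum_le_sum fun S' _ => ?_
        by_cases h : S = S'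
        · simp [h, sq_nonneg]
        · simpa only [if_pos h, ne_eq] using sum_mem_mem_collisions_le hb sb hl hl0 h
    _ = _ := by
        simp [𝓟, Finset.card_powersetCard]
        ring

end Collision

/-! ### Likelihood ratio of the bits in one bin -/

section Bin

variable {T C : Type*} [Fintype T] [DecidableEq T] [Fintype C] [DecidableEq C]

open scoped Classical in
/-- The likelihood ratio of the bits `β` for samples in the cells `x`, when the parity of the bits
in each cell `c` of `L` is fixed by the bit `ε c`. -/
noncomputable def likelihood (L : C → Prop) (x : T → C) (ε : C → Bool) (β : T → Bool × Bool) : ℝ :=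
  ∏ t, (1 + if L (x t) then bitSign (ε (x t)) * parity (β t) else 0)

/-- The average of `likelihood` over uniformly random `ε`. -/
noncomputable def avgLikelihood (L : C → Prop) (x : T → C) (β : T → Bool × Bool) : ℝ :=
  (2 ^ Fintype.card C)⁻¹ * ∑ ε, likelihood L x ε β

theorem likelihood_nonneg (L : C → Prop) (x : T → C) (ε : C → Bool) (β : T → Bool × Bool) :
    0 ≤ likelihood L x ε β := by
  refine Finset.prod_nonneg fun t _ => ?_
  split_ifs
  · rcases parity_cases (β t) with h | h <;> cases ε (x t) <;> simp [h, bitSign]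
  · norm_num

theorem avgLikelihood_nonneg (L : C → Prop) (x : T → C) (β : T → Bool × Bool) :
    0 ≤ avgLikelihood L x β :=
  mul_nonneg (by positivity) (Finset.sum_nonneg fun ε _ => likelihood_nonneg L x ε β)

theorem sum_likelihood (L : C → Prop) (x : T → C) (ε : C → Bool) :
    ∑ β, likelihood L x ε β = 4 ^ Fintype.card T := by
  classical
  simp only [likelihood]
  rw [← Fintype.piFinset_univ, ← Finset.prod_univ_sum (fun _ => univ)
    (fun t b => (1 + if L (x t) then bitSign (ε (x t)) * parity b else 0))]
  have : ∀ t, ∑ b, (1 + if L (x t) then bitSign (ε (x t)) * parity b else 0) = 4 := by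
    intro t
    rw [Finset.sum_add_distrib]
    split_ifs
    · rw [← Finset.mul_sum, sum_parity]; simp
    · simp
  rw [Finset.prod_congr rfl fun t _ => this t]
  simp

theorem sum_avgLikelihood (L : C → Prop) (x : T → C) :
    ∑ β, avgLikelihood L x β = 4 ^ Fintype.card T := by
  simp only [avgLikelihood, ← Finset.mul_sum]
  rw [Finset.sum_comm]
  simp [sum_likelihood]

open scoped Classical in
-- The random signs of different cells are independent, so the average factors over cells, with two
-- sign choices in each.
theorem avgLikelihood_eq_prod (L : C → Prop) (x : T → C) (β : T → Bool × Bool) :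
    avgLikelihood L x β = ∏ c, if L c then
      (∏ t ∈ univ.filter (x · = c), (1 + parity (β t)) +
        ∏ t ∈ univ.filter (x · = c), (1 - parity (β t))) / 2 else 1 := by
  have h1 : ∀ ε, likelihood L x ε β = ∏ c, ∏ t ∈ univ.filter (x · = c),
      (1 + if L c then bitSign (ε c) * parity (β t) else 0) := by
    intro ε
    rw [likelihood, ← Finset.prod_fiberwise univ x]
    refine Finset.prod_congr rfl fun c _ => Finset.prod_congr rfl fun t ht => ?_
    rw [(mem_filter.mp ht).2]
  simp only [avgLikelihood, h1]
  rw [← Fintype.piFinset_univ, ← Finset.prod_univ_sum (fun _ => univ) (fun c e =>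
    ∏ t ∈ univ.filter (x · = c), (1 + if L c then bitSign e * parity (β t) else 0))]
  rw [← Finset.card_univ, ← Finset.prod_const, ← Finset.prod_inv_distrib,
    ← Finset.prod_mul_distrib]
  refine Finset.prod_congr rfl fun c _ => ?_
  by_cases hc : L c
  · simp [hc, bitSign, sub_eq_add_neg]; ring
  · simp [hc]

open scoped Classical in
theorem powersetCard_fiber_subset_collisions {L : C → Prop} (x : T → C) {c : C} (hc : L c) :
    powersetCard 2 (univ.filter (x · = c)) ⊆ collisions L x := by
  intro S hS
  rw [mem_powersetCard] at hS
  exact mem_collisions.mpr ⟨hS.2, c, hc, fun t ht => (mem_filter.mp (hS.1 ht)).2⟩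

theorem half_sum_eq_one_of_card_le_one {ι : Type*} {s : Finset ι} (hs : s.card ≤ 1) (f : ι → ℝ) :
    (∏ t ∈ s, (1 + f t) + ∏ t ∈ s, (1 - f t)) / 2 = 1 := by
  rcases Nat.le_one_iff_eq_zero_or_eq_one.mp hs with h | h
  · rw [Finset.card_eq_zero.mp h]; norm_num
  · obtain ⟨t, rfl⟩ := Finset.card_eq_one.mp h
    simp

theorem avgLikelihood_of_collisions_eq_empty {L : C → Prop} {x : T → C}
    (h : collisions L x = ∅) (β : T → Bool × Bool) : avgLikelihood L x β = 1 := by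
  classical
  rw [avgLikelihood_eq_prod]
  refine Finset.prod_eq_one fun c _ => ?_
  split_ifs with hc
  · refine half_sum_eq_one_of_card_le_one ?_ _
    have := powersetCard_fiber_subset_collisions x hc
    rw [h, Finset.subset_empty, Finset.powersetCard_eq_empty] at this
    omega
  · rfl

/-- Averaging (1 ± p)(1 ± p') over the common sign leaves 1 + pp'; every other cell of `L` holds at
most one sample and contributes 1. -/
theorem avgLikelihood_of_collisions_eq_singleton {L : C → Prop} {x : T → C} {S : Finset T}
    (h : collisions L x = {S}) (β : T → Bool × Bool) :
    avgLikelihood L x β = 1 + character S β := by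
  classical
  obtain ⟨hS, c₀, hc₀, hx⟩ := mem_collisions.mp (h ▸ mem_singleton_self S : S ∈ collisions L x)
  have hsub : S ⊆ univ.filter (x · = c₀) := fun t ht => by simp [hx t ht]
  rw [avgLikelihood_eq_prod, Fintype.prod_eq_single c₀]
  -- Three samples in one cell would already give three colliding pairs.
  · have hle : (univ.filter (x · = c₀)).card ≤ 2 := by
      have := Finset.card_le_card (powersetCard_fiber_subset_collisions x hc₀)
      rw [h, Finset.card_singleton, Finset.card_powersetCard] at this
      by_contra! h3
      have := (Nat.choose_le_choose 2 h3).trans this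
      norm_num [Nat.choose] at this
    rw [← Finset.eq_of_subset_of_card_le hsub (by omega), if_pos hc₀]
    obtain ⟨t, t', htt, rfl⟩ := Finset.card_eq_two.mp hS
    rw [character, Finset.prod_pair htt, Finset.prod_pair htt, Finset.prod_pair htt]
    ring
  · intro c hc
    split_ifs with hLc
    · refine half_sum_eq_one_of_card_le_one ?_ _
      by_contra! h2
      obtain ⟨S', hS'⟩ := Finset.powersetCard_nonempty.mpr h2
      have := powersetCard_fiber_subset_collisions x hLc hS'
      rw [h, mem_singleton] at this
      subst this
      obtain ⟨t, ht⟩ := Finset.card_pos.mp (by omega : 0 < S'.card)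
      exact hc ((mem_filter.mp ((mem_powersetCard.mp hS').1 ht)).2 ▸ hx t ht)
    · rfl

open scoped Classical in
/-- `avgLikelihood` with all terms dropped in the event of several collisions. -/
noncomputable def truncLikelihood (L : C → Prop) (x : T → C) (β : T → Bool × Bool) : ℝ :=
  1 + ∑ S ∈ powersetCard 2 univ, (if collisions L x = {S} then 1 else 0) * character S β

theorem truncLikelihood_of_collisions_eq_singleton {L : C → Prop} {x : T → C} {S : Finset T}
    (h : collisions L x = {S}) (β : T → Bool × Bool) :
    truncLikelihood L x β = 1 + character S β := by
  have hS := (mem_collisions.mp (h ▸ mem_singleton_self S : S ∈ collisions L x)).1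
  rw [truncLikelihood, Finset.sum_eq_single S]
  · simp [h]
  · intro S' _ hne
    simp [h, hne.symm]
  · intro hS'
    simp [mem_powersetCard, hS] at hS'

theorem truncLikelihood_of_card_ne_one {L : C → Prop} {x : T → C}
    (h : (collisions L x).card ≠ 1) (β : T → Bool × Bool) :
    truncLikelihood L x β = 1 := by
  rw [truncLikelihood, Finset.sum_eq_zero, add_zero]
  intro S _
  rw [if_neg, zero_mul]
  intro hS
  exact h (by rw [hS, Finset.card_singleton])

/-- Truncation replaces the density by 1 instead of 0, so it still yields a probability law, as the
hybrid argument requires. -/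
theorem truncLikelihood_nonneg (L : C → Prop) (x : T → C) (β : T → Bool × Bool) :
    0 ≤ truncLikelihood L x β := by
  by_cases h : (collisions L x).card = 1
  · obtain ⟨S, hS⟩ := Finset.card_eq_one.mp h
    rw [truncLikelihood_of_collisions_eq_singleton hS,
      ← avgLikelihood_of_collisions_eq_singleton hS]
    exact avgLikelihood_nonneg L x β
  · rw [truncLikelihood_of_card_ne_one h]; norm_num

theorem sum_truncLikelihood (L : C → Prop) (x : T → C) :
    ∑ β, truncLikelihood L x β = 4 ^ Fintype.card T := by
  classical
  simp only [truncLikelihood]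
  rw [Finset.sum_add_distrib, Finset.sum_comm, Finset.sum_eq_zero (s := powersetCard 2 univ)]
  · simp
  · intro S hS
    rw [← Finset.mul_sum, sum_character, mul_zero]
    exact Finset.card_pos.mp (by rw [(mem_powersetCard.mp hS).2]; norm_num)

open scoped Classical in
theorem sum_abs_avgLikelihood_sub_truncLikelihood_le (L : C → Prop) (x : T → C) :
    ∑ β, |avgLikelihood L x β - truncLikelihood L x β| ≤
      2 * 4 ^ Fintype.card T * if 2 ≤ (collisions L x).card then 1 else 0 := by
  split_ifs with h
  · calc _ ≤ ∑ β, (avgLikelihood L x β + truncLikelihood L x β) := by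
          refine Finset.sum_le_sum fun β _ => (abs_sub _ _).trans ?_
          rw [abs_of_nonneg (avgLikelihood_nonneg L x β),
            abs_of_nonneg (truncLikelihood_nonneg L x β)]
      _ = _ := by
          rw [Finset.sum_add_distrib, sum_avgLikelihood, sum_truncLikelihood]; ring
  · rw [mul_zero]
    refine le_of_eq (Finset.sum_eq_zero fun β _ => ?_)
    rw [abs_eq_zero, sub_eq_zero]
    obtain h | h : (collisions L x).card = 0 ∨ (collisions L x).card = 1 := by omega
    · rw [avgLikelihood_of_collisions_eq_empty (Finset.card_eq_zero.mp h),
        truncLikelihood_of_card_ne_one (by omega)]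
    · obtain ⟨S, hS⟩ := Finset.card_eq_one.mp h
      rw [truncLikelihood_of_collisions_eq_singleton hS,
        avgLikelihood_of_collisions_eq_singleton hS]

/-! ### Averaging over the hidden weights of a bin -/

section Mixture

variable {Θ : Type*} [Fintype Θ] {w : Θ → ℝ} {b : Θ → C → ℝ} {L : Θ → C → Prop}

/-- The law of the samples in a mixture of product laws of the cells with weights `b θ`, whose bits
have density `g θ` relative to the uniform law. -/
noncomputable def binLaw (w : Θ → ℝ) (b : Θ → C → ℝ) (g : Θ → (T → C) → (T → Bool × Bool) → ℝ)
    (d : T → C × Bool × Bool) : ℝ :=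
  (4 ^ Fintype.card T)⁻¹ *
    ∑ θ, w θ * (∏ t, b θ (d t).1) * g θ (fun t => (d t).1) (fun t => (d t).2)

theorem sum_data (F : (T → C) → (T → Bool × Bool) → ℝ) :
    ∑ d : T → C × Bool × Bool, F (fun t => (d t).1) (fun t => (d t).2) = ∑ x, ∑ β, F x β := by
  rw [← Fintype.sum_prod_type']
  exact Fintype.sum_equiv (Equiv.arrowProdEquivProdArrow T (fun _ => C) (fun _ => Bool × Bool)) _ _
    (fun d => rfl)

theorem sum_binLaw (sw : ∑ θ, w θ = 1) (sb : ∀ θ, ∑ c, b θ c = 1)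
    {g : Θ → (T → C) → (T → Bool × Bool) → ℝ}
    (hg : ∀ θ x, ∑ β, g θ x β = 4 ^ Fintype.card T) : ∑ d, binLaw w b g d = 1 := by
  simp only [binLaw, ← Finset.mul_sum]
  rw [sum_data fun x β => ∑ θ, w θ * (∏ t, b θ (x t)) * g θ x β]
  have : ∀ x : T → C, ∑ β, ∑ θ, w θ * (∏ t, b θ (x t)) * g θ x β =
      4 ^ Fintype.card T * ∑ θ, w θ * ∏ t, b θ (x t) := by
    intro x
    rw [Finset.sum_comm, Finset.mul_sum]
    refine Finset.sum_congr rfl fun θ _ => ?_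
    rw [← Finset.mul_sum, hg, mul_comm]
  simp only [this]
  rw [← Finset.mul_sum, Finset.sum_comm]
  simp [← Finset.mul_sum, sum_pi_prod_eq_one (sb _), sw]

theorem binLaw_nonneg (hw : ∀ θ, 0 ≤ w θ) (hb : ∀ θ c, 0 ≤ b θ c)
    {g : Θ → (T → C) → (T → Bool × Bool) → ℝ} (hg : ∀ θ x β, 0 ≤ g θ x β)
    (d : T → C × Bool × Bool) : 0 ≤ binLaw w b g d :=
  mul_nonneg (by positivity) (Finset.sum_nonneg fun θ _ =>
    mul_nonneg (mul_nonneg (hw θ) (Finset.prod_nonneg fun t _ => hb θ _)) (hg θ _ _))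

theorem binLaw_one_pos (hw : ∀ θ, 0 ≤ w θ) (sw : ∑ θ, w θ = 1) (hb : ∀ θ c, 0 < b θ c)
    (d : T → C × Bool × Bool) : 0 < binLaw w b (fun _ _ _ => 1) d := by
  refine mul_pos (by positivity) ?_
  obtain ⟨θ, -, hθ⟩ := Finset.exists_lt_of_sum_lt (s := univ) (f := fun _ => (0 : ℝ)) (g := w)
    (by simp [sw])
  refine Finset.sum_pos' (fun θ _ => ?_) ⟨θ, mem_univ θ, ?_⟩
  · rw [mul_one]
    exact mul_nonneg (hw θ) (Finset.prod_nonneg fun t _ => (hb θ _).le)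
  · rw [mul_one]
    exact mul_pos hθ (Finset.prod_pos fun t _ => hb θ _)

/-- The two densities differ only when at least two pairs collide, and then by at most 2 in ℓ¹. -/
theorem sum_abs_binLaw_sub_le (hw : ∀ θ, 0 ≤ w θ) (sw : ∑ θ, w θ = 1) (hb : ∀ θ c, 0 ≤ b θ c)
    (sb : ∀ θ, ∑ c, b θ c = 1) {l : ℝ} (hl : ∀ θ c, L θ c → b θ c ≤ l) (hl0 : 0 ≤ l) :
    ∑ d : T → C × Bool × Bool, |binLaw w b (fun θ => avgLikelihood (L θ)) d -
        binLaw w b (fun θ => truncLikelihood (L θ)) d| ≤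
      2 * ((Fintype.card T).choose 2 : ℝ) ^ 2 * l ^ 2 := by
  classical
  have h4 : (0 : ℝ) < (4 ^ Fintype.card T)⁻¹ := by positivity
  calc _ ≤ ∑ d : T → C × Bool × Bool, (4 ^ Fintype.card T)⁻¹ * ∑ θ, w θ * ((∏ t, b θ (d t).1) *
        |avgLikelihood (L θ) (fun t => (d t).1) (fun t => (d t).2) -
          truncLikelihood (L θ) (fun t => (d t).1) (fun t => (d t).2)|) := by
        refine Finset.sum_le_sum fun d _ => ?_
        rw [binLaw, binLaw, ← mul_sub, abs_mul, abs_of_pos h4, ← Finset.sum_sub_distrib]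
        refine mul_le_mul_of_nonneg_left ((Finset.abs_sum_le_sum_abs _ _).trans
          (Finset.sum_le_sum fun θ _ => le_of_eq ?_)) h4.le
        rw [← mul_sub, abs_mul, abs_mul, abs_of_nonneg (hw θ),
          abs_of_nonneg (Finset.prod_nonneg fun t _ => hb θ _), mul_assoc]
    _ = (4 ^ Fintype.card T)⁻¹ * ∑ θ, w θ * ∑ x : T → C, (∏ t, b θ (x t)) *
        ∑ β, |avgLikelihood (L θ) x β - truncLikelihood (L θ) x β| := by
        rw [← Finset.mul_sum, Finset.sum_comm]
        congr 1
        refine Finset.sum_congr rfl fun θ _ => ?_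
        rw [← Finset.mul_sum, sum_data fun x β => (∏ t, b θ (x t)) *
          |avgLikelihood (L θ) x β - truncLikelihood (L θ) x β|]
        simp only [← Finset.mul_sum]
    _ ≤ (4 ^ Fintype.card T)⁻¹ * ∑ θ, w θ * (2 * 4 ^ Fintype.card T *
          (((Fintype.card T).choose 2 : ℝ) ^ 2 * l ^ 2)) := by
        refine mul_le_mul_of_nonneg_left (Finset.sum_le_sum fun θ _ =>
          mul_le_mul_of_nonneg_left ?_ (hw θ)) h4.le
        refine le_trans ?_ (mul_le_mul_of_nonneg_left
          (sum_two_le_card_collisions_le (T := T) (hb θ) (sb θ) (hl θ) hl0) (by positivity))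
        rw [Finset.mul_sum]
        refine Finset.sum_le_sum fun x _ => ?_
        rw [mul_left_comm]
        exact mul_le_mul_of_nonneg_left (sum_abs_avgLikelihood_sub_truncLikelihood_le (L θ) x)
          (Finset.prod_nonneg fun t _ => hb θ _)
    _ = _ := by
        rw [← Finset.sum_mul, sw]
        field_simp

open scoped Classical in
-- Let `A x` be the mass of the cells `x`, and `p x S` the part of it where `S` is the only
-- collision in `L`. Parseval turns the χ² divergence into the sum of p²/A. One factor p is bounded
-- by τA through the posterior hypothesis `hτ`, and the other sums over `x` to at most `l`.
theorem sum_sq_binLaw_div_le (hw : ∀ θ, 0 ≤ w θ) (sw : ∑ θ, w θ = 1) (hb : ∀ θ c, 0 < b θ c)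
    (sb : ∀ θ, ∑ c, b θ c = 1) {l : ℝ} (hl : ∀ θ c, L θ c → b θ c ≤ l) (hl0 : 0 ≤ l) {τ : ℝ}
    (hτ0 : 0 ≤ τ) (hτ : ∀ (x : T → C) (t t' : T), t ≠ t' → x t = x t' →
      ∑ θ, w θ * (∏ t, b θ (x t)) * (if L θ (x t) then 1 else 0) ≤
        τ * ∑ θ, w θ * ∏ t, b θ (x t)) :
    ∑ d : T → C × Bool × Bool, binLaw w b (fun θ => truncLikelihood (L θ)) d ^ 2 /
        binLaw w b (fun _ _ _ => 1) d ≤ 1 + (Fintype.card T).choose 2 * (τ * l) := by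
  let A : (T → C) → ℝ := fun x => ∑ θ, w θ * ∏ t, b θ (x t)
  let p : (T → C) → Finset T → ℝ := fun x S =>
    ∑ θ, w θ * (∏ t, b θ (x t)) * (if collisions (L θ) x = {S} then 1 else 0)
  let 𝓟 : Finset (Finset T) := powersetCard 2 univ
  have h𝓟 : ∀ S ∈ 𝓟, S.Nonempty := fun S hS =>
    Finset.card_pos.mp (by rw [(mem_powersetCard.mp hS).2]; norm_num)
  have hwb : ∀ θ (x : T → C), 0 ≤ w θ * ∏ t, b θ (x t) := fun θ x =>
    mul_nonneg (hw θ) (Finset.prod_nonneg fun t _ => (hb θ _).le)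
  have hA : ∀ x, 0 < A x := by
    intro x
    have := binLaw_one_pos hw sw hb (fun t => (x t, true, true))
    simp only [binLaw, mul_one] at this
    exact pos_of_mul_pos_right this (by positivity)
  have hp0 : ∀ x S, 0 ≤ p x S := fun x S =>
    Finset.sum_nonneg fun θ _ => mul_nonneg (hwb θ x) (by positivity)
  have hpA : ∀ x, ∀ S ∈ 𝓟, p x S ≤ τ * A x := by
    intro x S hS
    obtain ⟨t, t', htt, rfl⟩ := Finset.card_eq_two.mp (mem_powersetCard.mp hS).2
    by_cases hx : x t = x t'
    · refine le_trans (Finset.sum_le_sum fun θ _ => mul_le_mul_of_nonneg_left ?_ (hwb θ x))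
        (hτ x t t' htt hx)
      by_cases h : collisions (L θ) x = {{t, t'}}
      · obtain ⟨-, c, hc, hx'⟩ := mem_collisions.mp (h ▸ mem_singleton_self _ :
          {t, t'} ∈ collisions (L θ) x)
        rw [if_pos h, hx' t (by simp), if_pos hc]
      · rw [if_neg h]; split_ifs <;> norm_num
    · have : ∀ θ, collisions (L θ) x ≠ {{t, t'}} := by
        intro θ h
        obtain ⟨-, c, hc, hx'⟩ := mem_collisions.mp (h ▸ mem_singleton_self _ :
          {t, t'} ∈ collisions (L θ) x)
        exact hx ((hx' t (by simp)).trans (hx' t' (by simp)).symm)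
      simp only [p, this, if_false, mul_zero, Finset.sum_const_zero]
      exact mul_nonneg hτ0 (hA x).le
  have hpl : ∀ S, ∑ x, p x S ≤ l := by
    intro S
    rw [Finset.sum_comm]
    calc _ ≤ ∑ θ, w θ * l := by
          refine Finset.sum_le_sum fun θ _ => ?_
          simp only [mul_assoc]
          rw [← Finset.mul_sum]
          refine mul_le_mul_of_nonneg_left (le_trans (Finset.sum_le_sum fun x _ => ?_)
            (sum_mem_collisions_le (T := T) (fun c => (hb θ c).le) (sb θ) (hl θ) hl0 S)) (hw θ)
          refine mul_le_mul_of_nonneg_left ?_ (Finset.prod_nonneg fun t _ => (hb θ _).le)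
          by_cases h : collisions (L θ) x = {S}
          · simp [h]
          · rw [if_neg h]; positivity
      _ = l := by rw [← Finset.sum_mul, sw, one_mul]
  have htrunc : ∀ (x : T → C) β, ∑ θ, w θ * (∏ t, b θ (x t)) * truncLikelihood (L θ) x β =
      A x + ∑ S ∈ 𝓟, p x S * character S β := by
    intro x β
    simp only [truncLikelihood, mul_add, mul_one, Finset.sum_add_distrib, A, p]
    congr 1
    simp only [Finset.sum_mul, Finset.mul_sum]
    rw [Finset.sum_comm]
    refine Finset.sum_congr rfl fun S _ => Finset.sum_congr rfl fun θ _ => by ring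
  calc _ = ∑ x : T → C, ∑ β : T → Bool × Bool,
        ((4 ^ Fintype.card T)⁻¹ * (A x + ∑ S ∈ 𝓟, p x S * character S β)) ^ 2 /
          ((4 ^ Fintype.card T)⁻¹ * A x) := by
        rw [← sum_data]
        refine Finset.sum_congr rfl fun d _ => ?_
        rw [binLaw, htrunc, binLaw]
        simp only [mul_one, A]
    _ = ∑ x, (A x + ∑ S ∈ 𝓟, p x S ^ 2 / A x) := by
        refine Finset.sum_congr rfl fun x _ => ?_
        simp only [mul_pow]
        rw [← Finset.sum_div, ← Finset.mul_sum, sum_sq_add_sum_character 𝓟 h𝓟, ← Finset.sum_div]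
        have := (hA x).ne'
        field_simp
    _ ≤ ∑ x, (A x + ∑ S ∈ 𝓟, τ * p x S) := by
        refine Finset.sum_le_sum fun x _ => add_le_add_right (Finset.sum_le_sum fun S hS => ?_) _
        rw [div_le_iff₀ (hA x)]
        nlinarith [hpA x S hS, hp0 x S]
    _ = 1 + ∑ S ∈ 𝓟, τ * ∑ x, p x S := by
        rw [Finset.sum_add_distrib, Finset.sum_comm (t := 𝓟)]
        congr 1
        · simp only [A]
          rw [Finset.sum_comm]
          simp [← Finset.mul_sum, sum_pi_prod_eq_one (sb _), sw]
        · exact Finset.sum_congr rfl fun S _ => (Finset.mul_sum _ _ _).symm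
    _ ≤ 1 + ∑ S ∈ 𝓟, τ * l := by
        gcongr with S hS
        exact hpl S
    _ = _ := by simp [𝓟, Finset.card_powersetCard]

end Mixture

end Bin

/-! ### Posterior probability that a repeated row is light -/

section RowWeight

variable {I : Type*} [Fintype I] [DecidableEq I]

/-- The law on `I` that spreads mass `1 / 2` uniformly over a set `R` of `h` heavy elements, and
mass `1 / 2` uniformly over the others. -/
noncomputable def rowWeight (h : ℕ) (R : Finset I) (i : I) : ℝ :=
  if i ∈ R then 1 / (2 * h) else 1 / (2 * (Fintype.card I - h))

theorem rowWeight_pos {h : ℕ} (h0 : 0 < h) (hI : 2 * h ≤ Fintype.card I) (R : Finset I) (i : I) :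
    0 < rowWeight h R i := by
  have h1 : (0 : ℝ) < h := by exact_mod_cast h0
  have h2 : (2 : ℝ) * h ≤ Fintype.card I := by exact_mod_cast hI
  rw [rowWeight]
  split_ifs
  · positivity
  · exact div_pos one_pos (by linarith)

theorem sum_rowWeight {h : ℕ} (h0 : 0 < h) (hI : 2 * h ≤ Fintype.card I) {R : Finset I}
    (hR : R.card = h) : ∑ i, rowWeight h R i = 1 := by
  have h1 : (0 : ℝ) < h := by exact_mod_cast h0
  have h2 : (2 : ℝ) * h ≤ Fintype.card I := by exact_mod_cast hI
  have h3 : ((univ.filter fun i => i ∉ R).card : ℝ) = Fintype.card I - h := by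
    rw [← hR, ← Nat.cast_sub (Finset.card_le_univ R), ← Finset.card_compl]
    congr 2
    ext; simp
  have h4 : (univ.filter fun i => i ∈ R).card = h := by simp [hR]
  simp only [rowWeight]
  rw [Finset.sum_ite, Finset.sum_const, Finset.sum_const, h4, nsmul_eq_mul, nsmul_eq_mul, h3]
  have h5 : (Fintype.card I : ℝ) - h ≠ 0 := by
    intro h; linarith
  field_simp
  norm_num

/-- If two of at most `h / 2` samples fall on the same element, then this element is heavy with high
posterior probability. -/
theorem sum_prod_rowWeight_light_le {T : Type*} [Fintype T] [DecidableEq T] {h : ℕ} (h0 : 0 < h)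
    (hI : 2 * h ≤ Fintype.card I) (hT : 2 * Fintype.card T ≤ h) (r : T → I) {t t' : T}
    (htt : t ≠ t') (hr : r t = r t') :
    ∑ R ∈ powersetCard h univ, (∏ s, rowWeight h R (r s)) * (if r t ∉ R then 1 else 0) ≤
      2 * Fintype.card I * h / (Fintype.card I - h) ^ 2 *
        ∑ R ∈ powersetCard h univ, ∏ s, rowWeight h R (r s) := by
  have h1 : (0 : ℝ) < h := by exact_mod_cast h0
  have h2 : (2 : ℝ) * h ≤ Fintype.card I := by exact_mod_cast hI
  have h3 : (0 : ℝ) < Fintype.card I - h := by linarith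
  set m : ℝ := (Fintype.card I : ℝ) with hm
  set i := r t with hi
  let W : Finset I → ℝ := fun R => ∏ s, rowWeight h R (r s)
  have hW : ∀ R, 0 < W R := fun R => Finset.prod_pos fun s _ => rowWeight_pos h0 hI R _
  -- The ratio of heavy to light weight; it is at least 1 because 2h ≤ m.
  let ρ : ℝ := (m - h) / h
  have hρ : 0 < ρ := div_pos h3 h1
  -- Exchange a sample-free `u` for the light element `i`. Only samples at `i` change weight, and
  -- both `t` and `t'` gain a factor ρ.
  have hswap : ∀ R u, i ∉ R → u ∉ univ.image r → ρ ^ 2 * W R ≤ W (insert i (R.erase u)) := by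
    intro R u hiR hu
    have hc : ∏ s, (if s ∈ ({t, t'} : Finset T) then ρ else 1) = ρ ^ 2 := by
      rw [Finset.prod_ite_mem, Finset.univ_inter, Finset.prod_const, Finset.card_pair htt]
    rw [← hc, ← Finset.prod_mul_distrib]
    refine Finset.prod_le_prod (fun s _ => ?_) fun s _ => ?_
    · have := (rowWeight_pos h0 hI R (r s)).le
      split_ifs <;> positivity
    · by_cases hs : r s = i
      · have e1 : rowWeight h R (r s) = 1 / (2 * (m - h)) := by
          rw [rowWeight, if_neg (by rwa [hs])]
        have e2 : rowWeight h (insert i (R.erase u)) (r s) = 1 / (2 * h) := by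
          rw [rowWeight, if_pos (by simp [hs])]
        rw [e1, e2]
        split_ifs
        · apply le_of_eq
          simp only [ρ]
          field_simp
        · rw [one_mul]
          exact one_div_le_one_div_of_le (by linarith) (by linarith)
      · have hs1 : s ∉ ({t, t'} : Finset T) := by
          simp only [mem_insert, mem_singleton, not_or]
          exact ⟨fun h => hs (h ▸ rfl), fun h => hs (by rw [h, ← hr])⟩
        have hs2 : r s ≠ u := fun h => hu (h ▸ Finset.mem_image_of_mem r (mem_univ s))
        rw [if_neg hs1, one_mul, rowWeight, rowWeight]
        simp [hs, hs2]
  -- The samples meet at most h/2 elements, so at least half of the heavy ones are available for the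
  -- exchange.
  have hcard : ∀ R ∈ powersetCard h (univ : Finset I), (h : ℝ) / 2 ≤
      ∑ u, if u ∈ R ∧ u ∉ univ.image r then 1 else 0 := by
    intro R hR
    rw [← Finset.sum_filter, Finset.sum_const, nsmul_eq_mul, mul_one]
    have e1 : (univ.filter fun u => u ∈ R ∧ u ∉ univ.image r) = R \ univ.image r := by
      ext u; simp
    have e2 := Finset.le_card_sdiff (univ.image r) R
    have e3 : (univ.image r).card ≤ Fintype.card T := Finset.card_image_le
    rw [(mem_powersetCard.mp hR).2] at e2
    rw [e1]
    have : h ≤ 2 * (R \ univ.image r).card := by omega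
    have : (h : ℝ) ≤ 2 * (R \ univ.image r).card := by exact_mod_cast this
    linarith
  have hu : ∀ u, ∑ R ∈ powersetCard h univ,
      (if i ∉ R ∧ u ∈ R ∧ u ∉ univ.image r then W (insert i (R.erase u)) else 0) ≤
        ∑ R ∈ powersetCard h univ, W R := by
    intro u
    rw [← Finset.sum_filter]
    rw [← Finset.sum_image (g := fun R : Finset I => insert i (R.erase u)) (f := W)]
    · refine Finset.sum_le_sum_of_subset_of_nonneg ?_ fun R _ _ => (hW R).le
      intro R' hR'
      obtain ⟨R, hR, rfl⟩ := Finset.mem_image.mp hR'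
      obtain ⟨hR, hiR, huR, -⟩ := mem_filter.mp hR
      rw [mem_powersetCard] at hR ⊢
      refine ⟨subset_univ _, ?_⟩
      rw [Finset.card_insert_of_notMem (fun h => hiR (Finset.mem_of_mem_erase h)),
        Finset.card_erase_of_mem huR, hR.2]
      omega
    · intro R hR S hS hRS
      obtain ⟨-, hiR, huR, -⟩ := mem_filter.mp hR
      obtain ⟨-, hiS, huS, -⟩ := mem_filter.mp hS
      have := congrArg (fun Q => insert u (Finset.erase Q i)) hRS
      simp only at this
      rwa [Finset.erase_insert (fun h => hiR (Finset.mem_of_mem_erase h)),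
        Finset.erase_insert (fun h => hiS (Finset.mem_of_mem_erase h)),
        Finset.insert_erase huR, Finset.insert_erase huS] at this
  -- Double counting of pairs (R, u): each R without `i` admits at least h/2 exchanges, and for each
  -- of the m values of u the exchange is injective.
  have key : (h : ℝ) / 2 * ρ ^ 2 * ∑ R ∈ powersetCard h univ, W R * (if i ∉ R then 1 else 0) ≤
      m * ∑ R ∈ powersetCard h univ, W R := by
    calc _ ≤ ∑ R ∈ powersetCard h univ, ∑ u,
          (if i ∉ R ∧ u ∈ R ∧ u ∉ univ.image r then W (insert i (R.erase u)) else 0) := by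
          rw [Finset.mul_sum]
          refine Finset.sum_le_sum fun R hR => ?_
          by_cases hiR : i ∈ R
          · simp [hiR]
          · rw [if_pos hiR, mul_one, mul_assoc]
            refine (mul_le_mul_of_nonneg_right (hcard R hR)
              (mul_nonneg (sq_nonneg ρ) (hW R).le)).trans ?_
            rw [Finset.sum_mul]
            refine Finset.sum_le_sum fun u _ => ?_
            by_cases hu : u ∈ R ∧ u ∉ univ.image r
            · rw [if_pos hu, if_pos ⟨hiR, hu⟩, one_mul]
              exact hswap R u hiR hu.2
            · rw [if_neg hu, if_neg (fun h => hu h.2), zero_mul]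
      _ ≤ ∑ u : I, ∑ R ∈ powersetCard h univ, W R := by
          rw [Finset.sum_comm]
          exact Finset.sum_le_sum fun u _ => hu u
      _ = _ := by rw [Finset.sum_const, Finset.card_univ, nsmul_eq_mul]
  have hpos : 0 < (h : ℝ) / 2 * ρ ^ 2 := by positivity
  have := (le_div_iff₀' hpos).mpr key
  refine this.trans (le_of_eq ?_)
  simp only [ρ, W]
  field_simp

end RowWeight

/-! ### Hidden states and sample laws of a bin -/

section Model

variable {I : Type*} [Fintype I] [DecidableEq I]

/-- The sets of `h` heavy elements. -/
abbrev HeavySet (I : Type*) [Fintype I] (h : ℕ) : Type _ :=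
  {R : Finset I // R ∈ powersetCard h univ}

/-- The law of the cells for heavy rows `θ.1` and heavy columns `θ.2`. -/
noncomputable def cellWeight {h : ℕ} (θ : HeavySet I h × HeavySet I h) (c : I × I) : ℝ :=
  rowWeight h θ.1.1 c.1 * rowWeight h θ.2.1 c.2

/-- The cells in a light row and a light column. -/
def IsLight {h : ℕ} (θ : HeavySet I h × HeavySet I h) (c : I × I) : Prop :=
  c.1 ∉ θ.1.1 ∧ c.2 ∉ θ.2.1

instance {h : ℕ} (θ : HeavySet I h × HeavySet I h) (c : I × I) : Decidable (IsLight θ c) :=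
  inferInstanceAs (Decidable (_ ∧ _))

/-- The uniform prior on pairs of heavy sets. -/
noncomputable def heavyPrior {h : ℕ} (_ : HeavySet I h × HeavySet I h) : ℝ :=
  (Fintype.card (HeavySet I h) : ℝ)⁻¹ ^ 2

theorem heavyPrior_nonneg {h : ℕ} (θ : HeavySet I h × HeavySet I h) : 0 ≤ heavyPrior θ := by
  rw [heavyPrior]; positivity

theorem sum_heavyPrior {h : ℕ} (hI : 2 * h ≤ Fintype.card I) :
    ∑ θ : HeavySet I h × HeavySet I h, heavyPrior θ = 1 := by
  have : 0 < Fintype.card (HeavySet I h) := by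
    rw [Fintype.card_coe, Finset.card_powersetCard, Finset.card_univ]
    exact Nat.choose_pos (by omega)
  have : (0 : ℝ) < Fintype.card (HeavySet I h) := by exact_mod_cast this
  simp only [heavyPrior, Finset.sum_const, Finset.card_univ, Fintype.card_prod, nsmul_eq_mul]
  push_cast
  field_simp

theorem cellWeight_pos {h : ℕ} (h0 : 0 < h) (hI : 2 * h ≤ Fintype.card I)
    (θ : HeavySet I h × HeavySet I h) (c : I × I) : 0 < cellWeight θ c :=
  mul_pos (rowWeight_pos h0 hI _ _) (rowWeight_pos h0 hI _ _)

theorem sum_cellWeight {h : ℕ} (h0 : 0 < h) (hI : 2 * h ≤ Fintype.card I)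
    (θ : HeavySet I h × HeavySet I h) : ∑ c, cellWeight θ c = 1 := by
  simp only [cellWeight]
  rw [Fintype.sum_prod_type]
  simp only [← Finset.mul_sum, sum_rowWeight h0 hI (mem_powersetCard.mp θ.2.2).2,
    sum_rowWeight h0 hI (mem_powersetCard.mp θ.1.2).2, mul_one]

theorem cellWeight_of_isLight {h : ℕ} {θ : HeavySet I h × HeavySet I h} {c : I × I}
    (hc : IsLight θ c) : cellWeight θ c = (1 / (2 * (Fintype.card I - h))) ^ 2 := by
  rw [cellWeight, rowWeight, rowWeight, if_neg hc.1, if_neg hc.2, sq]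

/-- Heavy rows and heavy columns are independent a priori and the likelihood is a product, so the
row and column bounds multiply. -/
theorem sum_prod_cellWeight_light_le {T : Type*} [Fintype T] [DecidableEq T] {h : ℕ} (h0 : 0 < h)
    (hI : 2 * h ≤ Fintype.card I) (hT : 2 * Fintype.card T ≤ h) (x : T → I × I) {t t' : T}
    (htt : t ≠ t') (hx : x t = x t') :
    ∑ θ : HeavySet I h × HeavySet I h, heavyPrior θ * (∏ s, cellWeight θ (x s)) *
        (if IsLight θ (x t) then 1 else 0) ≤
      (2 * Fintype.card I * h / (Fintype.card I - h) ^ 2) ^ 2 *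
        ∑ θ : HeavySet I h × HeavySet I h, heavyPrior θ * ∏ s, cellWeight θ (x s) := by
  set τ : ℝ := 2 * Fintype.card I * h / (Fintype.card I - h) ^ 2 with hτdef
  have hτ : 0 ≤ τ := by positivity
  let κ : ℝ := (Fintype.card (HeavySet I h) : ℝ)⁻¹ ^ 2
  have hκ : 0 ≤ κ := by positivity
  have e1 : ∀ f g : Finset I → ℝ, ∑ θ : HeavySet I h × HeavySet I h, κ * (f θ.1.1 * g θ.2.1) =
      κ * ((∑ R ∈ powersetCard h univ, f R) * ∑ R ∈ powersetCard h univ, g R) := by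
    intro f g
    rw [← Finset.mul_sum, Fintype.sum_prod_type, ← Finset.sum_coe_sort _ f,
      ← Finset.sum_coe_sort _ g, Finset.sum_mul_sum]
  have e2 : ∀ θ : HeavySet I h × HeavySet I h, heavyPrior θ * ∏ s, cellWeight θ (x s) =
      κ * ((∏ s, rowWeight h θ.1.1 (x s).1) * ∏ s, rowWeight h θ.2.1 (x s).2) := by
    intro θ
    rw [← Finset.prod_mul_distrib]
    rfl
  have e3 : ∀ θ : HeavySet I h × HeavySet I h, heavyPrior θ * (∏ s, cellWeight θ (x s)) *
      (if IsLight θ (x t) then 1 else 0) =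
      κ * (((∏ s, rowWeight h θ.1.1 (x s).1) * if (x t).1 ∉ θ.1.1 then 1 else 0) *
        ((∏ s, rowWeight h θ.2.1 (x s).2) * if (x t).2 ∉ θ.2.1 then 1 else 0)) := by
    intro θ
    rw [e2]
    have : (if IsLight θ (x t) then (1 : ℝ) else 0) =
        (if (x t).1 ∉ θ.1.1 then 1 else 0) * (if (x t).2 ∉ θ.2.1 then 1 else 0) := by
      rw [ite_zero_mul_ite_zero, one_mul]
      rfl
    rw [this]
    ring
  simp only [e3]
  simp only [e2]
  rw [e1 (fun R => (∏ s, rowWeight h R (x s).1) * if (x t).1 ∉ R then 1 else 0)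
    (fun R => (∏ s, rowWeight h R (x s).2) * if (x t).2 ∉ R then 1 else 0),
    e1 (fun R => ∏ s, rowWeight h R (x s).1) (fun R => ∏ s, rowWeight h R (x s).2)]
  have i1 := sum_prod_rowWeight_light_le h0 hI hT (fun s => (x s).1) htt (congrArg Prod.fst hx)
  have i2 := sum_prod_rowWeight_light_le h0 hI hT (fun s => (x s).2) htt (congrArg Prod.snd hx)
  have n1 : ∀ y : T → I, 0 ≤ ∑ R ∈ powersetCard h univ, ∏ s, rowWeight h R (y s) := fun y =>
    Finset.sum_nonneg fun R _ => Finset.prod_nonneg fun s _ => (rowWeight_pos h0 hI R _).le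
  rw [mul_left_comm (τ ^ 2)]
  refine mul_le_mul_of_nonneg_left ?_ hκ
  refine (mul_le_mul i1 i2 (Finset.sum_nonneg fun R _ => mul_nonneg
    (Finset.prod_nonneg fun s _ => (rowWeight_pos h0 hI R _).le) (by positivity))
    (mul_nonneg hτ (n1 _))).trans (le_of_eq ?_)
  rw [← hτdef]
  ring

/-- The hidden state of a bin: heavy rows, heavy columns, and a bit for each cell. -/
abbrev BinState (I : Type*) [Fintype I] (h : ℕ) : Type _ :=
  (HeavySet I h × HeavySet I h) × (I × I → Bool)

/-- The uniform prior on bin states. -/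
noncomputable def binPrior {h : ℕ} (ψ : BinState I h) : ℝ :=
  heavyPrior ψ.1 * (2 ^ Fintype.card (I × I))⁻¹

/-- The law of a sample of a conditionally independent bin. -/
noncomputable def nullLaw {h : ℕ} (ψ : BinState I h) (d : (I × I) × Bool × Bool) : ℝ :=
  cellWeight ψ.1 d.1 / 4

/-- The law of a sample of a bin where the bits are perfectly correlated in light cells. -/
noncomputable def altLaw {h : ℕ} (ψ : BinState I h) (d : (I × I) × Bool × Bool) : ℝ :=
  cellWeight ψ.1 d.1 / 4 *
    (1 + if IsLight ψ.1 d.1 then bitSign (ψ.2 d.1) * parity d.2 else 0)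

theorem binPrior_nonneg {h : ℕ} (ψ : BinState I h) : 0 ≤ binPrior ψ :=
  mul_nonneg (heavyPrior_nonneg _) (by positivity)

theorem sum_binPrior {h : ℕ} (hI : 2 * h ≤ Fintype.card I) :
    ∑ ψ : BinState I h, binPrior ψ = 1 := by
  simp only [binPrior]
  rw [Fintype.sum_prod_type]
  simp only [Finset.sum_const, Finset.card_univ, Fintype.card_fun, Fintype.card_bool, nsmul_eq_mul]
  push_cast
  rw [← sum_heavyPrior hI]
  refine Finset.sum_congr rfl fun θ _ => ?_
  field_simp

theorem sum_binPrior_nullLaw {T : Type*} [Fintype T] {h : ℕ} (d : T → (I × I) × Bool × Bool) :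
    ∑ ψ : BinState I h, binPrior ψ * ∏ t, nullLaw ψ (d t) =
      binLaw heavyPrior (cellWeight (h := h)) (fun _ _ _ => 1) d := by
  simp only [binPrior, nullLaw, binLaw, mul_one]
  rw [Fintype.sum_prod_type, Finset.mul_sum]
  refine Finset.sum_congr rfl fun θ _ => ?_
  simp only [Finset.sum_const, Finset.card_univ, Fintype.card_fun, Fintype.card_bool, nsmul_eq_mul,
    Finset.prod_div_distrib, Finset.prod_const]
  push_cast
  field_simp

theorem sum_binPrior_altLaw {T : Type*} [Fintype T] {h : ℕ} (d : T → (I × I) × Bool × Bool) :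
    ∑ ψ : BinState I h, binPrior ψ * ∏ t, altLaw ψ (d t) =
      binLaw heavyPrior (cellWeight (h := h)) (fun θ => avgLikelihood (IsLight θ)) d := by
  simp only [binPrior, altLaw, binLaw, avgLikelihood, likelihood]
  rw [Fintype.sum_prod_type, Finset.mul_sum]
  refine Finset.sum_congr rfl fun θ _ => ?_
  simp only [Finset.mul_sum, Finset.prod_mul_distrib, Finset.prod_div_distrib, Finset.prod_const,
    Finset.card_univ]
  refine Finset.sum_congr rfl fun ε _ => ?_
  -- The two sides differ only in their decidability instances.
  have : ∏ t, (1 + if IsLight θ (d t).1 then bitSign (ε (d t).1) * parity (d t).2 else 0) =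
    ∏ t, (1 + @ite _ (IsLight θ (d t).1) (Classical.propDecidable _)
      (bitSign (ε (d t).1) * parity (d t).2) 0) := by
    refine Finset.prod_congr rfl fun t _ => ?_
    congr
  rw [this]
  field_simp

theorem nullLaw_nonneg {h : ℕ} (h0 : 0 < h) (hI : 2 * h ≤ Fintype.card I) (ψ : BinState I h)
    (d : (I × I) × Bool × Bool) : 0 ≤ nullLaw ψ d :=
  div_nonneg (cellWeight_pos h0 hI _ _).le (by norm_num)

theorem altLaw_nonneg {h : ℕ} (h0 : 0 < h) (hI : 2 * h ≤ Fintype.card I) (ψ : BinState I h)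
    (d : (I × I) × Bool × Bool) : 0 ≤ altLaw ψ d := by
  refine mul_nonneg (nullLaw_nonneg h0 hI ψ d) ?_
  split_ifs
  · rcases parity_cases d.2 with h | h <;> cases ψ.2 d.1 <;> simp [h, bitSign]
  · norm_num

theorem sum_nullLaw {h : ℕ} (h0 : 0 < h) (hI : 2 * h ≤ Fintype.card I) (ψ : BinState I h) :
    ∑ d, nullLaw ψ d = 1 := by
  simp only [nullLaw]
  rw [Fintype.sum_prod_type]
  refine Eq.trans ?_ (sum_cellWeight h0 hI ψ.1)
  refine Finset.sum_congr rfl fun c _ => ?_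
  simp
  ring

theorem sum_altLaw {h : ℕ} (h0 : 0 < h) (hI : 2 * h ≤ Fintype.card I) (ψ : BinState I h) :
    ∑ d, altLaw ψ d = 1 := by
  simp only [altLaw]
  rw [Fintype.sum_prod_type]
  refine Eq.trans ?_ (sum_cellWeight h0 hI ψ.1)
  refine Finset.sum_congr rfl fun c _ => ?_
  simp only
  rw [← Finset.mul_sum, Finset.sum_add_distrib]
  have : ∑ b, (if IsLight ψ.1 c then bitSign (ψ.2 c) * parity b else 0) = 0 := by
    split_ifs
    · rw [← Finset.mul_sum, sum_parity, mul_zero]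
    · simp
  rw [this]
  simp

end Model

/-! ### From single bins to labelled samples -/

section Mixture

variable {D Ψ : Type*} [Fintype D] [Fintype Ψ]

/-- The law of the samples in a bin with a hidden state of law `w`. -/
def binMixture (w : Ψ → ℝ) (μ : Ψ → D → ℝ) {T : Type*} [Fintype T] (d : T → D) : ℝ :=
  ∑ ψ, w ψ * ∏ t, μ ψ (d t)

theorem binMixture_nonneg {w : Ψ → ℝ} {μ : Ψ → D → ℝ} (hw : ∀ ψ, 0 ≤ w ψ) (hμ : ∀ ψ d, 0 ≤ μ ψ d)
    {T : Type*} [Fintype T] (d : T → D) : 0 ≤ binMixture w μ d :=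
  Finset.sum_nonneg fun ψ _ => mul_nonneg (hw ψ) (Finset.prod_nonneg fun _ _ => hμ ψ _)

theorem sum_binMixture {w : Ψ → ℝ} {μ : Ψ → D → ℝ} (sw : ∑ ψ, w ψ = 1) (sμ : ∀ ψ, ∑ d, μ ψ d = 1)
    {T : Type*} [Fintype T] [DecidableEq T] : ∑ d : T → D, binMixture w μ d = 1 := by
  classical
  simp only [binMixture]
  rw [Finset.sum_comm]
  simp only [← Finset.mul_sum, sum_pi_prod_eq_one (sμ _), mul_one, sw]

/-- The law of `s` samples with a uniform label in `Fin n`, when each label has an independent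
hidden state of law `w`. -/
noncomputable def mixture (w : Ψ → ℝ) (μ : Ψ → D → ℝ) {n s : ℕ} (x : Fin s → D × Fin n) : ℝ :=
  ∑ θ : Fin n → Ψ, (∏ z, w (θ z)) * ∏ t, (μ (θ (x t).2) (x t).1 / n)

theorem mixture_eq (w : Ψ → ℝ) (μ : Ψ → D → ℝ) {n s : ℕ} (ζ : Fin s → Fin n) (d : Fin s → D) :
    mixture w μ (fun t => (d t, ζ t)) =
      ((n : ℝ) ^ s)⁻¹ * ∏ z, binMixture w μ (fun t : {t // ζ t = z} => d t) := by
  simp only [mixture, binMixture]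
  rw [← sum_mixture_eq_prod, Finset.mul_sum]
  refine Finset.sum_congr rfl fun θ _ => ?_
  rw [Finset.prod_div_distrib]
  simp
  ring

/-- Condition on the labels, whose law is the same in both mixtures. Labelings with an overfull bin
get the trivial bound 2 and are rare by `card_large_fiber_le`. -/
theorem sum_abs_mixture_sub_le {w : Ψ → ℝ} {μ ν : Ψ → D → ℝ} (hw : ∀ ψ, 0 ≤ w ψ)
    (sw : ∑ ψ, w ψ = 1) (hμ : ∀ ψ d, 0 ≤ μ ψ d) (sμ : ∀ ψ, ∑ d, μ ψ d = 1)
    (hν : ∀ ψ d, 0 ≤ ν ψ d) (sν : ∀ ψ, ∑ d, ν ψ d = 1) {n s K : ℕ} (hn : 0 < n) {δ : ℝ}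
    (hδ0 : 0 ≤ δ)
    (hδ : ∀ ζ : Fin s → Fin n, (∀ z, Fintype.card {t // ζ t = z} ≤ K) →
      ∑ e : ∀ z, {t // ζ t = z} → D, |∏ z, binMixture w μ (e z) - ∏ z, binMixture w ν (e z)| ≤ δ) :
    ∑ x : Fin s → D × Fin n, |mixture w μ x - mixture w ν x| ≤
      δ + 2 * n * (1 + 1 / n) ^ s / 2 ^ K := by
  have hn' : (0 : ℝ) < n := by exact_mod_cast hn
  have hns : (0 : ℝ) < (n : ℝ) ^ s := by positivity
  have h1 : ∑ x : Fin s → D × Fin n, |mixture w μ x - mixture w ν x| =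
      ((n : ℝ) ^ s)⁻¹ * ∑ ζ : Fin s → Fin n, ∑ e : ∀ z, {t // ζ t = z} → D,
        |∏ z, binMixture w μ (e z) - ∏ z, binMixture w ν (e z)| := by
    rw [← (Equiv.arrowProdEquivProdArrow (Fin s) (fun _ => D) (fun _ => Fin n)).symm.sum_comp,
      Fintype.sum_prod_type_right, Finset.mul_sum]
    refine Finset.sum_congr rfl fun ζ _ => ?_
    rw [← sum_fiber, Finset.mul_sum]
    refine Finset.sum_congr rfl fun d _ => ?_
    change |mixture w μ (fun t => (d t, ζ t)) - mixture w ν (fun t => (d t, ζ t))| = _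
    rw [mixture_eq, mixture_eq, ← mul_sub, abs_mul, abs_of_pos (inv_pos.mpr hns)]
  have h2 : ∀ ζ : Fin s → Fin n, ∑ e : ∀ z, {t // ζ t = z} → D,
      |∏ z, binMixture w μ (e z) - ∏ z, binMixture w ν (e z)| ≤
        δ + if ∃ z, K < Fintype.card {t // ζ t = z} then 2 else 0 := by
    intro ζ
    split_ifs with h
    · have e1 : ∀ {μ : Ψ → D → ℝ}, (∀ ψ, ∑ d, μ ψ d = 1) →
          ∑ e : ∀ z, {t // ζ t = z} → D, ∏ z, binMixture w μ (e z) = 1 := by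
        intro μ sμ
        rw [← Fintype.piFinset_univ, ← Finset.prod_univ_sum (fun _ => univ)
          (fun z (e : {t // ζ t = z} → D) => binMixture w μ e)]
        exact Finset.prod_eq_one fun z _ => sum_binMixture sw sμ
      calc _ ≤ ∑ e : ∀ z, {t // ζ t = z} → D,
            (∏ z, binMixture w μ (e z) + ∏ z, binMixture w ν (e z)) := by
            refine Finset.sum_le_sum fun e _ => (abs_sub _ _).trans (le_of_eq ?_)
            rw [abs_of_nonneg (Finset.prod_nonneg fun z _ => binMixture_nonneg hw hμ _),
              abs_of_nonneg (Finset.prod_nonneg fun z _ => binMixture_nonneg hw hν _)]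
        _ = 2 := by rw [Finset.sum_add_distrib, e1 sμ, e1 sν]; norm_num
        _ ≤ _ := by linarith
    · push Not at h
      rw [add_zero]
      exact hδ ζ h
  rw [h1]
  calc _ ≤ ((n : ℝ) ^ s)⁻¹ * ∑ ζ : Fin s → Fin n,
        (δ + if ∃ z, K < Fintype.card {t // ζ t = z} then 2 else 0) :=
        mul_le_mul_of_nonneg_left (Finset.sum_le_sum fun ζ _ => h2 ζ) (inv_pos.mpr hns).le
    _ = δ + 2 * ((n : ℝ) ^ s)⁻¹ *
        (univ.filter fun ζ : Fin s → Fin n => ∃ z, K < Fintype.card {t // ζ t = z}).card := by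
        rw [Finset.sum_add_distrib, ← Finset.sum_filter]
        simp only [Finset.sum_const, Finset.card_univ, Fintype.card_fun, Fintype.card_fin,
          nsmul_eq_mul]
        push_cast
        field_simp
    _ ≤ _ := by
        have := card_large_fiber_le (n := n) (s := s) (K := K)
        rw [← le_div_iff₀ (by positivity)] at this
        refine add_le_add_right ((mul_le_mul_of_nonneg_left this (by positivity)).trans
          (le_of_eq ?_)) _
        have : (1 + 1 / (n : ℝ)) ^ s = (n + 1) ^ s / n ^ s := by
          rw [← div_pow]; congr 1; field_simp
        rw [this]
        field_simp

end Mixture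

/-- The three terms are the costs of several light collisions in a bin (truncation), of single ones
(χ²), and of overfull bins. -/
theorem sum_abs_mixture_altLaw_sub_nullLaw_le {I : Type*} [Fintype I] [DecidableEq I] {h n s K : ℕ}
    (h0 : 0 < h) (hI : 2 * h ≤ Fintype.card I) (hK : 2 * K ≤ h) (hn : 0 < n) {τ l : ℝ}
    (hτ : 2 * Fintype.card I * h / ((Fintype.card I : ℝ) - h) ^ 2 ≤ τ)
    (hl : (1 / (2 * ((Fintype.card I : ℝ) - h))) ^ 2 ≤ l) :
    ∑ x : Fin s → ((I × I) × Bool × Bool) × Fin n,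
      |mixture (binPrior (h := h)) altLaw x - mixture (binPrior (h := h)) nullLaw x| ≤
      n * (2 * ((K : ℝ) ^ 2 / 2) ^ 2 * l ^ 2) + √((1 + (K : ℝ) ^ 2 / 2 * (τ ^ 2 * l)) ^ n - 1) +
        2 * n * (1 + 1 / n) ^ s / 2 ^ K := by
  classical
  have hl0 : 0 ≤ l := (sq_nonneg _).trans hl
  have hτ0 : 0 ≤ τ := le_trans (by positivity) hτ
  refine sum_abs_mixture_sub_le binPrior_nonneg (sum_binPrior hI) (altLaw_nonneg h0 hI)
    (sum_altLaw h0 hI) (nullLaw_nonneg h0 hI) (sum_nullLaw h0 hI) hn (by positivity) ?_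
  intro ζ hζ
  have hb := fun (θ : HeavySet I h × HeavySet I h) c => (cellWeight_pos h0 hI θ c).le
  have hL : ∀ (θ : HeavySet I h × HeavySet I h) c, IsLight θ c → cellWeight θ c ≤ l :=
    fun θ c hc => (cellWeight_of_isLight hc).trans_le hl
  have hchoose : ∀ z, ((Fintype.card {t // ζ t = z}).choose 2 : ℝ) ≤ (K : ℝ) ^ 2 / 2 := by
    intro z
    have h1 : ((Fintype.card {t // ζ t = z}).choose 2 : ℝ) ≤ K.choose 2 := by
      exact_mod_cast Nat.choose_le_choose 2 (hζ z)
    refine h1.trans ((Nat.choose_le_pow_div 2 K).trans (le_of_eq ?_))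
    norm_num [Nat.factorial]
  have key := sum_abs_prod_sub_prod_le_add_sqrt (n := n)
    (E := fun z => {t // ζ t = z} → (I × I) × Bool × Bool)
    (fun z => binLaw heavyPrior (cellWeight (h := h)) (fun θ => avgLikelihood (IsLight θ)))
    (fun z => binLaw heavyPrior (cellWeight (h := h)) (fun θ => truncLikelihood (IsLight θ)))
    (fun z => binLaw heavyPrior (cellWeight (h := h)) (fun _ _ _ => 1))
    (fun z => binLaw_nonneg heavyPrior_nonneg hb fun θ => avgLikelihood_nonneg _)
    (fun z => binLaw_nonneg heavyPrior_nonneg hb fun θ => truncLikelihood_nonneg _)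
    (fun z => binLaw_one_pos heavyPrior_nonneg (sum_heavyPrior hI) (cellWeight_pos h0 hI))
    (fun z => sum_binLaw (sum_heavyPrior hI) (sum_cellWeight h0 hI) fun θ => sum_avgLikelihood _)
    (fun z => sum_binLaw (sum_heavyPrior hI) (sum_cellWeight h0 hI) fun θ => sum_truncLikelihood _)
    (fun z => sum_binLaw (sum_heavyPrior hI) (sum_cellWeight h0 hI) fun θ x => by simp)
    (b := 2 * ((K : ℝ) ^ 2 / 2) ^ 2 * l ^ 2) (χ := (K : ℝ) ^ 2 / 2 * (τ ^ 2 * l)) ?_ ?_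
  · simpa only [binMixture, sum_binPrior_altLaw, sum_binPrior_nullLaw] using key
  · intro z
    refine (sum_abs_binLaw_sub_le heavyPrior_nonneg (sum_heavyPrior hI) hb (sum_cellWeight h0 hI)
      hL hl0).trans ?_
    have := hchoose z
    gcongr
  · intro z
    refine (sum_sq_binLaw_div_le heavyPrior_nonneg (sum_heavyPrior hI) (cellWeight_pos h0 hI)
      (sum_cellWeight h0 hI) hL hl0 (τ := τ ^ 2) (by positivity) ?_).trans ?_
    · intro x t t' htt hx
      have h1 := sum_prod_cellWeight_light_le h0 hI
        ((Nat.mul_le_mul_left 2 (hζ z)).trans hK) x htt hx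
      have h2 : (2 * Fintype.card I * h / ((Fintype.card I : ℝ) - h) ^ 2) ^ 2 ≤ τ ^ 2 :=
        pow_le_pow_left₀ (by positivity) hτ 2
      have h3 := mul_le_mul_of_nonneg_right h2 (Finset.sum_nonneg fun θ (_ : θ ∈ univ) =>
        mul_nonneg (heavyPrior_nonneg θ) (Finset.prod_nonneg fun s (_ : s ∈ univ) => hb θ (x s)))
      refine le_trans (le_of_eq ?_) (h1.trans h3)
      refine Finset.sum_congr rfl fun θ _ => ?_
      congr
    · have := hchoose z
      gcongr

/-! ### Transport of laws along an injection -/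

section Extend

variable {Ω Ω' : Type*} [Fintype Ω] [Fintype Ω']

theorem sum_extend {e : Ω' → Ω} (he : e.Injective) (p : Ω' → ℝ) :
    ∑ ω, Function.extend e p 0 ω = ∑ ω', p ω' :=
  (Fintype.sum_of_injective e he _ _
    (fun ω hω => by rw [Function.extend_apply' _ _ _ hω]; rfl)
    (fun ω' => (he.extend_apply p 0 ω').symm)).symm

theorem extend_mem_stdSimplex {e : Ω' → Ω} (he : e.Injective) {p : Ω' → ℝ} (hp : ∀ ω', 0 ≤ p ω')
    (sp : ∑ ω', p ω' = 1) : Function.extend e p 0 ∈ stdSimplex ℝ Ω := by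
  refine ⟨fun ω => ?_, by rw [sum_extend he, sp]⟩
  by_cases hω : ∃ ω', e ω' = ω
  · obtain ⟨ω', rfl⟩ := hω
    rw [he.extend_apply]
    exact hp ω'
  · rw [Function.extend_apply' _ _ _ hω]; rfl

theorem acceptProb_extend {s : ℕ} (A : DecisionRule s Ω) {e : Ω' → Ω} (he : e.Injective)
    (p : Ω' → ℝ) : A.acceptProb (Function.extend e p 0) =
      ∑ x : Fin s → Ω', (∏ t, p (x t)) * A.accept (e ∘ x) := by
  refine (Fintype.sum_of_injective (fun x : Fin s → Ω' => e ∘ x) (he.comp_left) _ _ ?_ ?_).symm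
  · intro y hy
    have : ∃ t, ¬∃ ω', e ω' = y t := by
      by_contra! h
      choose x hx using h
      exact hy ⟨x, funext hx⟩
    obtain ⟨t, ht⟩ := this
    rw [Finset.prod_eq_zero (mem_univ t), zero_mul]
    rw [Function.extend_apply' _ _ _ ht]; rfl
  · intro x
    simp only [Function.comp_apply, he.extend_apply]

theorem acceptProb_add_rejectProb {s : ℕ} (A : DecisionRule s Ω) {p : Ω → ℝ} (sp : ∑ ω, p ω = 1) :
    A.acceptProb p + A.rejectProb p = 1 := by
  classical
  rw [DecisionRule.acceptProb, DecisionRule.rejectProb, ← Finset.sum_add_distrib]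
  refine Eq.trans ?_ (sum_pi_prod_eq_one (T := Fin s) sp)
  exact Finset.sum_congr rfl fun x _ => by ring

theorem half_sum_abs_sub_comp_le_tvDist_extend {e : Ω' → Ω} (he : e.Injective) (p : Ω' → ℝ)
    (q : Ω → ℝ) : 1 / 2 * ∑ ω', |p ω' - q (e ω')| ≤ tvDist (Function.extend e p 0) q := by
  rw [tvDist]
  refine mul_le_mul_of_nonneg_left ?_ (by norm_num)
  have : ∀ ω', |p ω' - q (e ω')| = |Function.extend e p 0 (e ω') - q (e ω')| := fun ω' => by
    rw [he.extend_apply]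
  simp only [this]
  refine (Finset.sum_map univ ⟨e, he⟩ (fun ω => |Function.extend e p 0 ω - q ω|)).symm.trans_le ?_
  exact Finset.sum_le_sum_of_subset_of_nonneg (subset_univ _) fun _ _ _ => abs_nonneg _

end Extend

/-! ### Conditional independence as rank one in each slice -/

section CondIndep

variable {X Y Z : Type*} [Fintype X] [Fintype Y] [Fintype Z]

theorem mem_condIndep_of_eq_mul {p : X × Y × Z → ℝ} (hp : p ∈ stdSimplex ℝ (X × Y × Z))
    (F : Z → X → ℝ) (G : Z → Y → ℝ) (h : ∀ x y z, p (x, y, z) = F z x * G z y) :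
    p ∈ condIndep X Y Z := by
  refine ⟨hp, fun x y z => ?_⟩
  have hZ : probZ p z = (∑ x, F z x) * ∑ y, G z y := by
    simp only [probZ, h, Finset.sum_mul_sum]
  simp only [condXY, condX, condY, hZ, h, ← Finset.mul_sum, ← Finset.sum_mul]
  by_cases h1 : ∑ x, F z x = 0
  · simp [h1]
  by_cases h2 : ∑ y, G z y = 0
  · simp [h2]
  field_simp

/-- Each slice is a rank-one matrix, so its 2 × 2 minors vanish. A slice of mass zero vanishes
entirely by nonnegativity, so the convention 0/0 = 0 is harmless. -/
theorem mul_eq_mul_of_mem_condIndep {q : X × Y × Z → ℝ} (hq : q ∈ condIndep X Y Z) (x x' : X)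
    (y y' : Y) (z : Z) : q (x, y, z) * q (x', y', z) = q (x, y', z) * q (x', y, z) := by
  by_cases hz : probZ q z = 0
  · have h0 : ∀ x y, q (x, y, z) = 0 := by
      intro x y
      rw [probZ, Finset.sum_eq_zero_iff_of_nonneg
        (fun _ _ => Finset.sum_nonneg fun _ _ => hq.1.1 _)] at hz
      have := hz x (mem_univ x)
      rw [Finset.sum_eq_zero_iff_of_nonneg (fun _ _ => hq.1.1 _)] at this
      exact this y (mem_univ y)
    simp [h0]
  · have h1 : ∀ x y, q (x, y, z) = condX q z x * condY q z y * probZ q z := by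
      intro x y
      rw [← hq.2 x y z, condXY, div_mul_cancel₀ _ hz]
    rw [h1 x y, h1 x' y', h1 x y', h1 x' y]
    ring

end CondIndep

/-! ### Distance of the alternative from conditional independence -/

section Far

variable {I : Type*} [Fintype I] [DecidableEq I]

/-- A correlated `2 × 2` block is far from every matrix of rank one. -/
theorem two_mul_le_of_mul_eq_mul {v a b c d : ℝ} (hb : 0 ≤ b) (hc : 0 ≤ c)
    (h : a * d = b * c) : 2 * v ≤ |2 * v - a| + |0 - b| + |0 - c| + |2 * v - d| := by
  rw [zero_sub, zero_sub, abs_neg, abs_neg, abs_of_nonneg hb, abs_of_nonneg hc]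
  by_contra! hlt
  have h1 := le_abs_self (2 * v - a)
  have h2 := le_abs_self (2 * v - d)
  have h3 := abs_nonneg (2 * v - a)
  have h4 := abs_nonneg (2 * v - d)
  -- Both diagonal entries then exceed b + c, so ad > (b + c)² ≥ bc, a contradiction.
  have h5 : b + c < a := by linarith
  have h6 : b + c < d := by linarith
  nlinarith [mul_pos (sub_pos.mpr h5) (sub_pos.mpr h6), mul_nonneg hb hc,
    mul_nonneg (add_nonneg hb hc) (sub_pos.mpr h5).le,
    mul_nonneg (add_nonneg hb hc) (sub_pos.mpr h6).le, sq_nonneg b, sq_nonneg c]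

theorem sum_rowWeight_light {h : ℕ} (h0 : 0 < h) (hI : 2 * h ≤ Fintype.card I) {R : Finset I}
    (hR : R.card = h) : ∑ i, (if i ∉ R then rowWeight h R i else 0) = 1 / 2 := by
  have h1 : (0 : ℝ) < h := by exact_mod_cast h0
  have h2 : ∑ i, (if i ∈ R then rowWeight h R i else 0) = 1 / 2 := by
    have : ∀ i, (if i ∈ R then rowWeight h R i else 0) = if i ∈ R then 1 / (2 * (h : ℝ)) else 0 := by
      intro i
      rw [rowWeight]
      split_ifs <;> rfl
    simp only [this]
    rw [← Finset.sum_filter]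
    simp [hR]
    field_simp
  have h3 : ∑ i, (if i ∈ R then rowWeight h R i else 0) +
      ∑ i, (if i ∉ R then rowWeight h R i else 0) = 1 := by
    rw [← Finset.sum_add_distrib, ← sum_rowWeight h0 hI hR]
    refine Finset.sum_congr rfl fun i _ => ?_
    by_cases hi : i ∈ R <;> simp [hi]
  linarith

theorem sum_cellWeight_light {h : ℕ} (h0 : 0 < h) (hI : 2 * h ≤ Fintype.card I)
    (θ : HeavySet I h × HeavySet I h) :
    ∑ c, (if IsLight θ c then cellWeight θ c else 0) = 1 / 4 := by
  have : ∀ c : I × I, (if IsLight θ c then cellWeight θ c else 0) =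
      (if c.1 ∉ θ.1.1 then rowWeight h θ.1.1 c.1 else 0) *
        (if c.2 ∉ θ.2.1 then rowWeight h θ.2.1 c.2 else 0) := by
    intro c
    rw [ite_zero_mul_ite_zero]
    rfl
  simp only [this]
  rw [Fintype.sum_prod_type]
  simp only [← Finset.sum_mul_sum]
  rw [sum_rowWeight_light h0 hI (mem_powersetCard.mp θ.1.2).2,
    sum_rowWeight_light h0 hI (mem_powersetCard.mp θ.2.2).2]
  norm_num

/-- The block of each light cell costs at least half of its mass, and light cells have mass 1/4 in
every bin. -/
theorem one_eighth_le_sum_abs_altLaw_sub {h n : ℕ} (hn : 0 < n) (h0 : 0 < h)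
    (hI : 2 * h ≤ Fintype.card I) (θ : Fin n → BinState I h)
    {q : ((I × I) × Bool × Bool) × Fin n → ℝ} (hq0 : ∀ ω, 0 ≤ q ω)
    (hq : ∀ c z a a' b b', q ((c, a, b), z) * q ((c, a', b'), z) =
      q ((c, a, b'), z) * q ((c, a', b), z)) :
    1 / 8 ≤ ∑ ω : ((I × I) × Bool × Bool) × Fin n, |altLaw (θ ω.2) ω.1 / n - q ω| := by
  have hn' : (n : ℝ) ≠ 0 := by exact_mod_cast hn.ne'
  have hblock : ∀ (z : Fin n) (c : I × I),
      (if IsLight (θ z).1 c then cellWeight (θ z).1 c else 0) * (1 / (2 * n)) ≤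
        ∑ β, |altLaw (θ z) (c, β) / n - q ((c, β), z)| := by
    intro z c
    split_ifs with hc
    · set v : ℝ := cellWeight (θ z).1 c / 4 / n with hv
      have e1 : ∀ a b, altLaw (θ z) (c, a, b) / n =
          v * (1 + bitSign ((θ z).2 c) * (bitSign a * bitSign b)) := by
        intro a b
        rw [altLaw]
        simp only [if_pos hc, parity, hv]
        ring
      have e2 : cellWeight (θ z).1 c * (1 / (2 * n)) = 2 * v := by
        rw [hv]; field_simp; norm_num
      rw [e2, Fintype.sum_prod_type]
      simp only [Fintype.sum_bool, e1]
      -- The bit decides whether the block is supported on equal or on unequal bits; the other two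
      -- entries play the role of `b` and `c`.
      cases (θ z).2 c
      · have := two_mul_le_of_mul_eq_mul (v := v)
          (hq0 ((c, true, true), z)) (hq0 ((c, false, false), z))
          (hq c z true false false true)
        simp only [bitSign] at *
        norm_num at *
        rw [mul_comm v 2]
        linarith
      · have := two_mul_le_of_mul_eq_mul (v := v)
          (hq0 ((c, true, false), z)) (hq0 ((c, false, true), z))
          (hq c z true false true false)
        simp only [bitSign] at *
        norm_num at *
        rw [mul_comm v 2]
        linarith
    · rw [zero_mul]
      exact Finset.sum_nonneg fun _ _ => abs_nonneg _
  calc (1 / 8 : ℝ) = ∑ z : Fin n, ∑ c : I × I,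
        (if IsLight (θ z).1 c then cellWeight (θ z).1 c else 0) * (1 / (2 * n)) := by
        simp only [← Finset.sum_mul, sum_cellWeight_light h0 hI]
        simp
        field_simp
        norm_num
    _ ≤ ∑ z : Fin n, ∑ c : I × I, ∑ β, |altLaw (θ z) (c, β) / n - q ((c, β), z)| :=
        Finset.sum_le_sum fun z _ => Finset.sum_le_sum fun c _ => hblock z c
    _ = _ := by
        rw [Fintype.sum_prod_type_right]
        exact Finset.sum_congr rfl fun z _ => (Fintype.sum_prod_type
          (fun d : (I × I) × Bool × Bool => |altLaw (θ z) d / n - q (d, z)|)).symm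

end Far

/-! ### From a tester to the distance of the mixtures -/

section Reduction

variable {X Y Z I : Type*} [Fintype X] [Fintype Y] [Fintype Z] [Fintype I] [DecidableEq I]

/-- The embedding of the domain of the hard instances into `X × Y × Z`. -/
def embed {n : ℕ} (eX : I × Bool ↪ X) (eY : I × Bool ↪ Y) (eZ : Fin n ≃ Z)
    (ω : ((I × I) × Bool × Bool) × Fin n) : X × Y × Z :=
  (eX (ω.1.1.1, ω.1.2.1), eY (ω.1.1.2, ω.1.2.2), eZ ω.2)

theorem embed_injective {n : ℕ} (eX : I × Bool ↪ X) (eY : I × Bool ↪ Y) (eZ : Fin n ≃ Z) :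
    (embed eX eY eZ).Injective := by
  rintro ⟨⟨⟨i, j⟩, a, b⟩, z⟩ ⟨⟨⟨i', j'⟩, a', b'⟩, z'⟩ h
  simp only [embed, Prod.mk.injEq, eX.injective.eq_iff, eY.injective.eq_iff,
    eZ.injective.eq_iff] at h
  obtain ⟨⟨rfl, rfl⟩, ⟨rfl, rfl⟩, rfl⟩ := h
  rfl

theorem extend_nullLaw_mem_condIndep {h n : ℕ} (hn : 0 < n) (h0 : 0 < h)
    (hI : 2 * h ≤ Fintype.card I) (eX : I × Bool ↪ X) (eY : I × Bool ↪ Y) (eZ : Fin n ≃ Z)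
    (θ : Fin n → BinState I h) :
    Function.extend (embed eX eY eZ) (fun ω => nullLaw (θ ω.2) ω.1 / n) 0 ∈ condIndep X Y Z := by
  have hn' : (n : ℝ) ≠ 0 := by exact_mod_cast hn.ne'
  refine mem_condIndep_of_eq_mul (extend_mem_stdSimplex (embed_injective eX eY eZ)
    (fun ω => div_nonneg (nullLaw_nonneg h0 hI _ _) n.cast_nonneg) ?_)
    (fun z => Function.extend eX (fun u => rowWeight h (θ (eZ.symm z)).1.1.1 u.1) 0)
    (fun z => Function.extend eY (fun u => rowWeight h (θ (eZ.symm z)).1.2.1 u.1 / 4 / n) 0) ?_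
  · rw [Fintype.sum_prod_type_right]
    simp only [← Finset.sum_div, sum_nullLaw h0 hI]
    simp [hn']
  · intro x y z
    by_cases hx : ∃ u, eX u = x
    · by_cases hy : ∃ u, eY u = y
      · obtain ⟨⟨i, a⟩, rfl⟩ := hx
        obtain ⟨⟨j, b⟩, rfl⟩ := hy
        have : (eX (i, a), eY (j, b), z) = embed eX eY eZ (((i, j), a, b), eZ.symm z) := by
          simp [embed]
        rw [this, (embed_injective eX eY eZ).extend_apply, eX.injective.extend_apply,
          eY.injective.extend_apply, nullLaw, cellWeight]
        ring
      · rw [Function.extend_apply' _ _ y hy, Function.extend_apply']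
        · simp
        · rintro ⟨ω, hω⟩
          exact hy ⟨_, congrArg (fun p => p.2.1) hω⟩
    · rw [Function.extend_apply' _ _ x hx, Function.extend_apply']
      · simp
      · rintro ⟨ω, hω⟩
        exact hx ⟨_, congrArg Prod.fst hω⟩

theorem isFar_extend_altLaw {h n : ℕ} (hn : 0 < n) (h0 : 0 < h)
    (hI : 2 * h ≤ Fintype.card I) (eX : I × Bool ↪ X) (eY : I × Bool ↪ Y) (eZ : Fin n ≃ Z)
    (θ : Fin n → BinState I h) :
    IsFar (1 / 20) (Function.extend (embed eX eY eZ) (fun ω => altLaw (θ ω.2) ω.1 / n) 0)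
      (condIndep X Y Z) := by
  intro q hq
  have h1 := half_sum_abs_sub_comp_le_tvDist_extend (embed_injective eX eY eZ)
    (fun ω => altLaw (θ ω.2) ω.1 / n) q
  have h2 := one_eighth_le_sum_abs_altLaw_sub hn h0 hI θ (q := fun ω => q (embed eX eY eZ ω))
    (fun ω => hq.1.1 _) (fun c z a a' b b' => mul_eq_mul_of_mem_condIndep hq _ _ _ _ _)
  linarith

theorem extend_altLaw_mem_stdSimplex {h n : ℕ} (hn : 0 < n) (h0 : 0 < h)
    (hI : 2 * h ≤ Fintype.card I) (eX : I × Bool ↪ X) (eY : I × Bool ↪ Y) (eZ : Fin n ≃ Z)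
    (θ : Fin n → BinState I h) :
    Function.extend (embed eX eY eZ) (fun ω => altLaw (θ ω.2) ω.1 / n) 0 ∈
      stdSimplex ℝ (X × Y × Z) := by
  have hn' : (n : ℝ) ≠ 0 := by exact_mod_cast hn.ne'
  refine extend_mem_stdSimplex (embed_injective eX eY eZ)
    (fun ω => div_nonneg (altLaw_nonneg h0 hI _ _) n.cast_nonneg) ?_
  rw [Fintype.sum_prod_type_right]
  simp only [← Finset.sum_div, sum_altLaw h0 hI]
  simp [hn']

/-- A tester separates the mixtures of the two families of hard instances. -/
theorem one_third_le_sum_abs_mixture_sub {h n s : ℕ} (hn : 0 < n) (h0 : 0 < h)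
    (hI : 2 * h ≤ Fintype.card I) (eX : I × Bool ↪ X) (eY : I × Bool ↪ Y) (eZ : Fin n ≃ Z)
    (A : DecisionRule s (X × Y × Z)) (hA : IsTester A (1 / 20)) :
    1 / 3 ≤ ∑ x : Fin s → ((I × I) × Bool × Bool) × Fin n,
      |mixture (binPrior (h := h)) altLaw x - mixture (binPrior (h := h)) nullLaw x| := by
  classical
  let e := embed eX eY eZ
  have he : e.Injective := embed_injective eX eY eZ
  have hw : ∀ θ : Fin n → BinState I h, 0 ≤ ∏ z, binPrior (θ z) := fun θ =>
    Finset.prod_nonneg fun z _ => binPrior_nonneg _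
  have sw : ∑ θ : Fin n → BinState I h, ∏ z, binPrior (θ z) = 1 :=
    sum_pi_prod_eq_one (sum_binPrior hI)
  have hmix : ∀ μ : BinState I h → (I × I) × Bool × Bool → ℝ,
      ∑ x, mixture binPrior μ x * A.accept (e ∘ x) = ∑ θ : Fin n → BinState I h,
        (∏ z, binPrior (θ z)) * A.acceptProb (Function.extend e (fun ω => μ (θ ω.2) ω.1 / n) 0) := by
    intro μ
    simp only [acceptProb_extend A he, mixture, Finset.sum_mul, Finset.mul_sum]
    rw [Finset.sum_comm]
    exact Finset.sum_congr rfl fun θ _ => Finset.sum_congr rfl fun x _ => mul_assoc _ _ _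
  have hnull : 2 / 3 ≤ ∑ x, mixture (binPrior (h := h)) nullLaw x * A.accept (e ∘ x) := by
    rw [hmix]
    calc (2 / 3 : ℝ) = ∑ θ : Fin n → BinState I h, (∏ z, binPrior (θ z)) * (2 / 3) := by
          rw [← Finset.sum_mul, sw, one_mul]
      _ ≤ _ := Finset.sum_le_sum fun θ _ => mul_le_mul_of_nonneg_left
          (hA.1 _ (extend_nullLaw_mem_condIndep hn h0 hI eX eY eZ θ)) (hw θ)
  have halt : ∑ x, mixture (binPrior (h := h)) altLaw x * A.accept (e ∘ x) ≤ 1 / 3 := by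
    rw [hmix]
    calc _ ≤ ∑ θ : Fin n → BinState I h, (∏ z, binPrior (θ z)) * (1 / 3) := by
          refine Finset.sum_le_sum fun θ _ => mul_le_mul_of_nonneg_left ?_ (hw θ)
          have hp := extend_altLaw_mem_stdSimplex hn h0 hI eX eY eZ θ
          have h1 := hA.2 _ hp (isFar_extend_altLaw hn h0 hI eX eY eZ θ)
          have h2 := acceptProb_add_rejectProb A hp.2
          change A.acceptProb (Function.extend (embed eX eY eZ) _ 0) ≤ _
          linarith
      _ = 1 / 3 := by rw [← Finset.sum_mul, sw, one_mul]
  calc (1 / 3 : ℝ) ≤ ∑ x, (mixture (binPrior (h := h)) nullLaw x * A.accept (e ∘ x) -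
        mixture (binPrior (h := h)) altLaw x * A.accept (e ∘ x)) := by
        rw [Finset.sum_sub_distrib]; linarith
    _ ≤ _ := by
        refine Finset.sum_le_sum fun x _ => ?_
        rw [← sub_mul, abs_sub_comm]
        refine (le_abs_self _).trans ?_
        rw [abs_mul, abs_of_nonneg (A.accept_nonneg _)]
        exact mul_le_of_le_one_right (abs_nonneg _) (A.accept_le_one _)

end Reduction

/-! ### Numerical estimates and conclusion -/

theorem rpow_fourth_root {n : ℕ} {y : ℝ} (hy : 0 ≤ y) (hyn : y ^ 4 = n) (k : ℕ) :
    (n : ℝ) ^ ((k : ℝ) / 4) = y ^ k := by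
  rw [← hyn, ← Real.rpow_natCast y 4, ← Real.rpow_mul hy, ← Real.rpow_natCast y k]
  congr 1
  push_cast
  ring

/-- With h and K of order y³ = n^(3/4), all powers of y cancel in the first two terms, leaving
constants made small by K ≤ h/1000. The third term decays exponentially in K. -/
theorem bound_lt_one_third {n s h K : ℕ} {y : ℝ} (hy : 10 ^ 6 ≤ y) (hyn : y ^ 4 = n)
    (hh : (h : ℝ) ≤ y ^ 3) (hKh : 1000 * (K : ℝ) ≤ h) (hKy : y ^ 3 / 2000 ≤ K)
    (hs : 4 * (s : ℝ) ≤ K * n) :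
    n * (2 * ((K : ℝ) ^ 2 / 2) ^ 2 * (9 / (n : ℝ) ^ 2) ^ 2) +
      √((1 + (K : ℝ) ^ 2 / 2 * ((24 * h / n) ^ 2 * (9 / (n : ℝ) ^ 2))) ^ n - 1) +
        2 * n * (1 + 1 / n) ^ s / 2 ^ K < 1 / 3 := by
  have y0 : 0 < y := by linarith
  have hK0 : (0 : ℝ) ≤ K := K.cast_nonneg
  have hh0 : (0 : ℝ) ≤ h := h.cast_nonneg
  have hn0 : (0 : ℝ) < n := by rw [← hyn]; positivity
  have hK : (K : ℝ) ≤ y ^ 3 / 1000 := by linarith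
  have t1 : n * (2 * ((K : ℝ) ^ 2 / 2) ^ 2 * (9 / (n : ℝ) ^ 2) ^ 2) ≤ 1 / 100 := by
    calc n * (2 * ((K : ℝ) ^ 2 / 2) ^ 2 * (9 / (n : ℝ) ^ 2) ^ 2)
        ≤ n * (2 * ((y ^ 3 / 1000) ^ 2 / 2) ^ 2 * (9 / (n : ℝ) ^ 2) ^ 2) := by gcongr
      _ = 81 / 2 / 1000 ^ 4 := by rw [← hyn]; field_simp; norm_num
      _ ≤ _ := by norm_num
  have t2 : (K : ℝ) ^ 2 / 2 * ((24 * h / n) ^ 2 * (9 / (n : ℝ) ^ 2)) ≤ 3 / 1000 / n := by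
    calc (K : ℝ) ^ 2 / 2 * ((24 * h / n) ^ 2 * (9 / (n : ℝ) ^ 2))
        ≤ (y ^ 3 / 1000) ^ 2 / 2 * ((24 * y ^ 3 / (n : ℝ)) ^ 2 * (9 / (n : ℝ) ^ 2)) := by gcongr
      _ = 2592 / 1000 ^ 2 / (n : ℝ) := by rw [← hyn]; field_simp; norm_num
      _ ≤ _ := div_le_div_of_nonneg_right (by norm_num) hn0.le
  have e1 : Real.exp (3 / 1000) ≤ 1 + 1 / 100 := by
    have h1 := Real.one_sub_le_exp_neg (3 / 1000)
    rw [Real.exp_neg] at h1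
    have h2 := Real.exp_pos (3 / 1000)
    have h3 : (1 - 3 / 1000) * Real.exp (3 / 1000) ≤ 1 := by
      calc _ ≤ (Real.exp (3 / 1000))⁻¹ * Real.exp (3 / 1000) := by gcongr
        _ = 1 := inv_mul_cancel₀ h2.ne'
    linarith
  have e2 : Real.exp (1 / 4) ≤ 4 / 3 := by
    have h1 := Real.one_sub_le_exp_neg (1 / 4)
    rw [Real.exp_neg] at h1
    have h2 := Real.exp_pos (1 / 4)
    have h3 : (1 - 1 / 4) * Real.exp (1 / 4) ≤ 1 := by
      calc _ ≤ (Real.exp (1 / 4))⁻¹ * Real.exp (1 / 4) := by gcongr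
        _ = 1 := inv_mul_cancel₀ h2.ne'
    linarith
  have t3 : √((1 + (K : ℝ) ^ 2 / 2 * ((24 * h / n) ^ 2 * (9 / (n : ℝ) ^ 2))) ^ n - 1) ≤ 1 / 10 := by
    refine Real.sqrt_le_iff.mpr ⟨by norm_num, ?_⟩
    have : (1 + (K : ℝ) ^ 2 / 2 * ((24 * h / n) ^ 2 * (9 / (n : ℝ) ^ 2))) ^ n ≤
        Real.exp (3 / 1000) := by
      calc _ ≤ (Real.exp (3 / 1000 / n)) ^ n := by
            gcongr
            have := Real.add_one_le_exp (3 / 1000 / (n : ℝ))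
            linarith
        _ = _ := by
            rw [← Real.exp_nat_mul]; congr 1; field_simp
    linarith
  have t4 : 2 * n * (1 + 1 / (n : ℝ)) ^ s / 2 ^ K ≤ 1 / 10 := by
    have p1 : (1 + 1 / (n : ℝ)) ^ s ≤ (4 / 3) ^ K := by
      calc (1 + 1 / (n : ℝ)) ^ s ≤ (Real.exp (1 / n)) ^ s := by
            gcongr
            have := Real.add_one_le_exp (1 / (n : ℝ))
            linarith
        _ = Real.exp (s / n) := by rw [← Real.exp_nat_mul]; congr 1; field_simp
        _ ≤ Real.exp (K * (1 / 4)) := by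
            apply Real.exp_le_exp.mpr
            rw [div_le_iff₀ hn0]; linarith
        _ = Real.exp (1 / 4) ^ K := Real.exp_nat_mul _ _
        _ ≤ _ := by gcongr
    -- The base 3/2 is 2 divided by 4/3. Bernoulli is linear in K, too weak against n, so it is
    -- applied to (6/5)^K and squared, using 36/25 ≤ 3/2.
    have p2 : 20 * (n : ℝ) ≤ (3 / 2) ^ K := by
      have b1 := one_add_mul_le_pow (a := (1 / 5 : ℝ)) (by norm_num) K
      have b2 : (1 / 5 * K : ℝ) ≤ (6 / 5) ^ K := by norm_num at b1 ⊢; linarith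
      calc 20 * (n : ℝ) = 20 * y ^ 4 := by rw [hyn]
        _ ≤ (y ^ 3 / 10000) ^ 2 := by
            have : 2000000000 ≤ y ^ 2 := by nlinarith
            have : 0 ≤ (y ^ 2 - 2000000000) * y ^ 4 := mul_nonneg (by linarith) (by positivity)
            nlinarith
        _ ≤ (1 / 5 * K) ^ 2 := by
            gcongr
            linarith
        _ ≤ ((6 / 5) ^ K) ^ 2 := by gcongr
        _ = (36 / 25) ^ K := by rw [← pow_mul, mul_comm, pow_mul]; norm_num
        _ ≤ _ := pow_le_pow_left₀ (by norm_num) (by norm_num) K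
    rw [div_le_iff₀ (by positivity)]
    have p3 : (2 : ℝ) ^ K = (4 / 3) ^ K * (3 / 2) ^ K := by rw [← mul_pow]; norm_num
    rw [p3]
    calc 2 * n * (1 + 1 / (n : ℝ)) ^ s ≤ 2 * n * (4 / 3) ^ K := by gcongr
      _ = 1 / 10 * ((4 / 3) ^ K * (20 * n)) := by ring
      _ ≤ _ := by gcongr
  linarith

end CondIndepTesting

theorem mainTheorem3 :
    ∃ c : ℝ, 0 < c ∧ ∃ n₀ : ℕ, ∀ n : ℕ, n₀ ≤ n →
      ∀ (X Y Z : Type*) [Fintype X] [Fintype Y] [Fintype Z],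
        Fintype.card X = n → Fintype.card Y = n → Fintype.card Z = n →
        ∀ (s : ℕ) (A : CondIndepTesting.DecisionRule s (X × Y × Z)),
          CondIndepTesting.IsTester A (1 / 20) → c * (n : ℝ) ^ (7 / 4 : ℝ) ≤ (s : ℝ) := by
  -- 8000 = 4 · 2000: as K ≥ y³/2000, a smaller s satisfies 4s ≤ Kn. The threshold 10²⁴ gives y ≥
  -- 10⁶.
  refine ⟨1 / 8000, by norm_num, 10 ^ 24, fun n hn X Y Z _ _ _ hX hY hZ s A hA => ?_⟩
  have hn1 : (10 : ℝ) ^ 24 ≤ n := by exact_mod_cast hn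
  have hn0 : 0 < n := lt_of_lt_of_le (by norm_num) hn
  let y : ℝ := (n : ℝ) ^ (1 / 4 : ℝ)
  have y0 : 0 ≤ y := by positivity
  have hyn : y ^ 4 = n := by
    rw [← Real.rpow_natCast, ← Real.rpow_mul n.cast_nonneg]
    norm_num
  have hy : 10 ^ 6 ≤ y := by
    by_contra! h
    have : y ^ 4 < (10 ^ 6) ^ 4 := by gcongr
    rw [hyn] at this
    norm_num at this hn1
    linarith
  have h7 : (n : ℝ) ^ (7 / 4 : ℝ) = y ^ 7 := by
    exact_mod_cast CondIndepTesting.rpow_fourth_root y0 hyn 7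
  rw [h7]
  by_contra! hs
  let h : ℕ := ⌊y ^ 3⌋₊
  let K : ℕ := h / 1000
  let m : ℕ := n / 2
  have y3 : (10 ^ 6) ^ 3 ≤ y ^ 3 := by gcongr
  norm_num at y3
  have hh : (h : ℝ) ≤ y ^ 3 := Nat.floor_le (by positivity)
  have hh' : y ^ 3 < h + 1 := Nat.lt_floor_add_one _
  have hKh : 1000 * K ≤ h := Nat.mul_div_le h 1000
  have hKh' : h < 1000 * (K + 1) := by omega
  have hKh1 : 1000 * (K : ℝ) ≤ h := by exact_mod_cast hKh
  have hKh2 : (h : ℝ) < 1000 * (K + 1) := by exact_mod_cast hKh'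
  have h0 : 0 < h := Nat.floor_pos.mpr (by linarith)
  have hm : (n : ℝ) ≤ 2 * m + 1 := by
    have : n ≤ 2 * m + 1 := by omega
    exact_mod_cast this
  have hhn : 1000 * (h : ℝ) ≤ n := by
    rw [← hyn]
    have : 1000 * y ^ 3 ≤ y * y ^ 3 := by gcongr; linarith
    linarith
  have hhm : 20 * (h : ℝ) ≤ m := by norm_num at hn1; linarith
  have hI : 2 * h ≤ Fintype.card (Fin m) := by
    rw [Fintype.card_fin]
    have : (2 : ℝ) * h ≤ m := by linarith
    exact_mod_cast this
  have hcard : Fintype.card (Fin m × Bool) ≤ n := by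
    rw [Fintype.card_prod, Fintype.card_fin, Fintype.card_bool]
    omega
  obtain ⟨eX⟩ := Function.Embedding.nonempty_of_card_le (hcard.trans hX.ge)
  obtain ⟨eY⟩ := Function.Embedding.nonempty_of_card_le (hcard.trans hY.ge)
  let eZ : Fin n ≃ Z := (Fintype.equivFinOfCardEq hZ).symm
  have lower := CondIndepTesting.one_third_le_sum_abs_mixture_sub (h := h) hn0 h0 hI eX eY eZ A hA
  have hnR : (0 : ℝ) < n := by exact_mod_cast hn0
  have hh0 : (0 : ℝ) < h := by exact_mod_cast h0
  have hmn : (m : ℝ) ≤ n := by exact_mod_cast Nat.div_le_self n 2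
  -- This yields, with room to spare, the posterior bound 24h/n and the light cell mass 9/n².
  have hmh : (n : ℝ) / 3 ≤ m - h := by linarith
  have upper := CondIndepTesting.sum_abs_mixture_altLaw_sub_nullLaw_le (I := Fin m) (n := n) (s := s)
    (K := K) (τ := 24 * h / n) (l := 9 / (n : ℝ) ^ 2) h0 hI (by omega) hn0 ?_ ?_
  · refine absurd (lower.trans upper) (not_le.mpr
      (CondIndepTesting.bound_lt_one_third hy hyn hh hKh1 (by linarith) ?_))
    rw [← hyn]
    have : y ^ 3 / 2000 * y ^ 4 ≤ K * y ^ 4 := by gcongr; linarith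
    nlinarith
  · rw [Fintype.card_fin, div_le_div_iff₀ (by nlinarith) hnR]
    have : (n : ℝ) * n / 9 ≤ (m - h) ^ 2 := by nlinarith
    have : 2 * (m : ℝ) * n ≤ 24 * (m - h) ^ 2 := by nlinarith
    nlinarith
  · rw [Fintype.card_fin]
    have h1 : 1 / (2 * ((m : ℝ) - h)) ≤ 3 / n := by
      rw [div_le_div_iff₀ (by linarith) hnR]
      linarith
    have h2 : 0 ≤ 1 / (2 * ((m : ℝ) - h)) := div_nonneg zero_le_one (by linarith)
    calc (1 / (2 * ((m : ℝ) - h))) ^ 2 ≤ (3 / n) ^ 2 := by gcongr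
      _ = 9 / (n : ℝ) ^ 2 := by rw [div_pow]; norm_num
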